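/- Let $\mathcal W=W(2,2)$ be the complex Lie algebra with basis $\{L_n,W_n,z\mid n\in\mathbb Z\}$ and brackets $$[L_n,L_m]=(m-n)L_{m+n}+\tfrac{n^3-n}{12}\delta_{m+n,0}z,\quad [L_n,W_m]=(m-n)W_{m+n}+\tfrac{n^3-n}{12}\delta_{m+n,0}z,\quad [W_n,W_m]=[z,W_m]=[z,L_m]=0,$$ and let $\mathcal W_+$ be the subalgebra spanned by all $L_n,W_n$ with $n>0$. Let $\varphi:\mathcal W_+\to\mathbb C$ be a Lie algebra homomorphism that is non-singular, i.e. $\varphi(L_i)\varphi(W_i)\ne 0$ for $i=1,2$. A Whittaker module of type $\varphi$ is a $\mathcal W$-module generated by a vector $v$ with $xv=\varphi(x)v$ for all $x\in\mathcal W_+$. Put $M_\varphi=\mathcal U(\mathcal W)\otimes_{\mathcal U(\mathcal W_+)}\mathbb C_\varphi$, where $\mathbb C_\varphi=\mathbb C$ with $x\in\mathcal W_+$ acting as multiplication by $\varphi(x)$, and $L_{\varphi,\xi}=M_\varphi/(z-\xi)M_\varphi$ for $\xi\in\mathbb C$. Theorem 4.2. (1) For every $\xi\in\mathbb C$, $L_{\varphi,\xi}$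 is a simple $\mathcal W$-module; it is a Whittaker module of type $\varphi$, and $z$ acts on it as the scalar $\xi$. (2) For $\xi,\xi'\in\mathbb C$, $L_{\varphi,\xi}\cong L_{\varphi,\xi'}$ as $\mathcal W$-modules if and only if $\xi=\xi'$. (3) For every simple Whittaker module $V$ of type $\varphi$ there is $\xi\in\mathbb C$ such that $z$ acts on $V$ as the scalar $\xi$ and $V\cong L_{\varphi,\xi}$. Thus simple Whittaker modules of type $\varphi$ are classified up to isomorphism by the scalar by which $z$ acts. -/

import Mathlib

open scoped TensorProduct

/-- Labels of the standard basis `{L n, W n, z | n ∈ ℤ}` of the Lie algebra `W(2,2)`. -/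
inductive W22Index : Type
  | L (n : ℤ)
  | W (n : ℤ)
  | z
  deriving DecidableEq

/-- The underlying complex vector space of `W(2,2)`, with basis indexed by `W22Index`. -/
def W22 : Type := W22Index →₀ ℂ

namespace W22

noncomputable section

instance : AddCommGroup W22 := inferInstanceAs (AddCommGroup (W22Index →₀ ℂ))

instance : Module ℂ W22 := inferInstanceAs (Module ℂ (W22Index →₀ ℂ))

/-- The standard basis of `W(2,2)`. -/
def basis : Module.Basis W22Index ℂ W22 := ⟨LinearEquiv.refl ℂ (W22Index →₀ ℂ)⟩

/-- The basis element `L n`. -/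
def L (n : ℤ) : W22 := basis (W22Index.L n)

/-- The basis element `W n`. -/
def W (n : ℤ) : W22 := basis (W22Index.W n)

/-- The central basis element `z`. -/
def z : W22 := basis W22Index.z

/-- The central term `((n ^ 3 - n) / 12) δ_{m + n, 0} z`. -/
def central (n m : ℤ) : W22 :=
  if m + n = 0 then (((n : ℂ) ^ 3 - n) / 12) • z else 0

/-- The bracket on basis elements. -/
def bracketBasis : W22Index → W22Index → W22
  | .L n, .L m => ((m : ℂ) - n) • L (m + n) + central n m
  | .L n, .W m => ((m : ℂ) - n) • W (m + n) + central n m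
  | .W n, .L m => -(((n : ℂ) - m) • W (n + m) + central m n)
  | .W _, .W _ => 0
  | .z, _ => 0
  | _, .z => 0

/-- The bilinear extension of `bracketBasis`. -/
def bracketLin : W22 →ₗ[ℂ] W22 →ₗ[ℂ] W22 :=
  basis.constr ℂ fun i => basis.constr ℂ fun j => bracketBasis i j

instance : Bracket W22 W22 := ⟨fun x y => bracketLin x y⟩

lemma bracket_def (x y : W22) : ⁅x, y⁆ = bracketLin x y := rfl

@[simp] lemma bracketLin_basis (i j : W22Index) :
    bracketLin (basis i) (basis j) = bracketBasis i j := by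
  simp [bracketLin]

lemma central_swap (n m : ℤ) : central n m = -central m n := by
  unfold central
  by_cases h : m + n = 0
  · have h' : n + m = 0 := by omega
    obtain rfl : m = -n := by omega
    rw [if_pos h, if_pos h', ← neg_smul]
    congr 1
    push_cast
    ring
  · have h' : ¬ n + m = 0 := by omega
    simp [h, h']

lemma bracketBasis_swap (i j : W22Index) : bracketBasis i j = -bracketBasis j i := by
  cases i <;> cases j <;> simp only [bracketBasis, neg_zero, neg_neg]
  case L.L n m =>
    rw [central_swap n m, add_comm m n, neg_add, ← neg_smul]
    congr 2
    ring

lemma bracketLin_swap (x y : W22) : bracketLin x y = -bracketLin y x := by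
  have h : bracketLin = -bracketLin.flip := by
    refine basis.ext fun i => basis.ext fun j => ?_
    simpa using bracketBasis_swap i j
  exact congrArg (fun f => f x y) h

lemma bracketLin_z_left (x : W22) : bracketLin z x = 0 := by
  have h : bracketLin z = 0 := basis.ext fun j => by
    simp only [z, bracketLin_basis, LinearMap.zero_apply]
    cases j <;> rfl
  rw [h, LinearMap.zero_apply]

lemma bracketLin_z_right (x : W22) : bracketLin x z = 0 := by
  rw [bracketLin_swap, bracketLin_z_left, neg_zero]

lemma bracketLin_L_L (n m : ℤ) :
    bracketLin (L n) (L m) = ((m : ℂ) - n) • L (m + n) + central n m := bracketLin_basis _ _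

lemma bracketLin_L_W (n m : ℤ) :
    bracketLin (L n) (W m) = ((m : ℂ) - n) • W (m + n) + central n m := bracketLin_basis _ _

lemma bracketLin_W_L (n m : ℤ) :
    bracketLin (W n) (L m) = -(((n : ℂ) - m) • W (n + m) + central m n) := bracketLin_basis _ _

lemma bracketLin_W_W (n m : ℤ) : bracketLin (W n) (W m) = 0 := bracketLin_basis _ _

lemma bracketLin_central_right (x : W22) (n m : ℤ) : bracketLin x (central n m) = 0 := by
  unfold central
  split_ifs <;> simp [bracketLin_z_right]

lemma bracketLin_central_left (x : W22) (n m : ℤ) : bracketLin (central n m) x = 0 := by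
  rw [bracketLin_swap, bracketLin_central_right, neg_zero]

/-- The cocycle identity behind the Jacobi identity. -/
lemma central_cocycle (n m k : ℤ) :
    ((k : ℂ) - m) • central n (k + m) =
      ((m : ℂ) - n) • central (m + n) k + ((k : ℂ) - n) • central m (k + n) := by
  unfold central
  by_cases h : k + m + n = 0
  · have h1 : k + (m + n) = 0 := by omega
    have h2 : k + n + m = 0 := by omega
    obtain rfl : k = -(m + n) := by omega
    rw [if_pos h, if_pos h1, if_pos h2]
    simp only [smul_smul, ← add_smul]
    congr 1
    push_cast
    ring
  · have h1 : ¬ k + (m + n) = 0 := by omega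
    have h2 : ¬ k + n + m = 0 := by omega
    simp [h, h1, h2]

lemma jacobi_basis (i j k : W22Index) :
    bracketLin (basis i) (bracketLin (basis j) (basis k)) =
      bracketLin (bracketLin (basis i) (basis j)) (basis k) +
        bracketLin (basis j) (bracketLin (basis i) (basis k)) := by
  have hL (n : ℤ) : basis (W22Index.L n) = L n := rfl
  have hW (n : ℤ) : basis (W22Index.W n) = W n := rfl
  have hz : basis W22Index.z = z := rfl
  have key (n m k : ℤ) (X : ℤ → W22) :
      ((k : ℂ) - m) • ((((k + m : ℤ) : ℂ) - n) • X (k + m + n) + central n (k + m)) =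
        ((m : ℂ) - n) • (((k : ℂ) - (m + n : ℤ)) • X (k + (m + n)) + central (m + n) k) +
        ((k : ℂ) - n) • ((((k + n : ℤ) : ℂ) - m) • X (k + n + m) + central m (k + n)) := by
    have h1 : k + (m + n) = k + m + n := by ring
    have h2 : k + n + m = k + m + n := by ring
    rw [smul_add, smul_add, smul_add, central_cocycle, h1, h2]
    push_cast
    module
  have key' (n m k : ℤ) :
      bracketLin (L n) (bracketLin (L m) (W k)) =
        bracketLin (bracketLin (L n) (L m)) (W k) +
          bracketLin (L m) (bracketLin (L n) (W k)) := by
    simpa only [bracketLin_L_L, bracketLin_L_W, map_add, map_smul, LinearMap.add_apply,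
      LinearMap.smul_apply, bracketLin_central_left, bracketLin_central_right, add_zero]
      using key n m k W
  cases i with
  | z => simp only [hz, bracketLin_z_left, LinearMap.map_zero, LinearMap.zero_apply, add_zero]
  | L n =>
    cases j with
    | z => simp only [hz, bracketLin_z_left, bracketLin_z_right, map_zero, LinearMap.zero_apply,
        add_zero]
    | L m =>
      cases k with
      | z => simp only [hz, bracketLin_z_right, map_zero, add_zero]
      | L k =>
        simpa only [hL, bracketLin_L_L, map_add, map_smul, LinearMap.add_apply,
          LinearMap.smul_apply, bracketLin_central_left, bracketLin_central_right, add_zero]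
          using key n m k L
      | W k => exact key' n m k
    | W m =>
      cases k with
      | z => simp only [hz, bracketLin_z_right, map_zero, add_zero]
      | L k =>
        have h := key' n k m
        rw [hL, hL, hW, bracketLin_swap (W m) (L k), bracketLin_swap _ (L k),
          bracketLin_swap (W m) (bracketLin (L n) (L k)), map_neg, h]
        abel
      | W k =>
        simp only [hL, hW, bracketLin_L_W, bracketLin_W_W, map_add, map_smul, map_zero,
          LinearMap.add_apply, LinearMap.smul_apply, bracketLin_central_left,
          bracketLin_central_right, add_zero, smul_zero]
  | W n =>
    cases j with
    | z => simp only [hz, bracketLin_z_left, bracketLin_z_right, map_zero, LinearMap.zero_apply,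
        add_zero]
    | L m =>
      cases k with
      | z => simp only [hz, bracketLin_z_right, map_zero, add_zero]
      | L k =>
        have h := key' m k n
        rw [hL, hL, hW, bracketLin_swap (W n) (bracketLin (L m) (L k)),
          bracketLin_swap (W n) (L m), bracketLin_swap (W n) (L k), map_neg, map_neg,
          LinearMap.neg_apply, bracketLin_swap (bracketLin (L m) (W n)) (L k), h]
        abel
      | W k =>
        simp only [hL, hW, bracketLin_L_W, bracketLin_W_L, bracketLin_W_W, map_add, map_smul,
          map_neg, map_zero, LinearMap.add_apply, LinearMap.smul_apply, LinearMap.neg_apply,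
          bracketLin_central_left, bracketLin_central_right, add_zero, smul_zero, neg_zero]
    | W m =>
      cases k with
      | z => simp only [hz, bracketLin_z_right, map_zero, add_zero]
      | L k =>
        simp only [hL, hW, bracketLin_W_L, bracketLin_W_W, map_add, map_smul, map_neg, map_zero,
          LinearMap.zero_apply, bracketLin_central_right, add_zero, smul_zero, neg_zero]
      | W k => simp only [hW, bracketLin_W_W, map_zero, LinearMap.zero_apply, add_zero]

lemma basis_induction {p : W22 → Prop} (smul : ∀ (c : ℂ) (i : W22Index), p (c • basis i))
    (add : ∀ x y, p x → p y → p (x + y)) (x : W22) : p x := by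
  rw [← basis.linearCombination_repr x, Finsupp.linearCombination_apply, Finsupp.sum]
  refine Finset.sum_induction _ p add ?_ fun i _ => smul _ i
  simpa using smul 0 W22Index.z

lemma jacobi (x y t : W22) :
    bracketLin x (bracketLin y t) =
      bracketLin (bracketLin x y) t + bracketLin y (bracketLin x t) := by
  induction x using basis_induction with
  | add a b ha hb =>
    simp only [map_add, LinearMap.add_apply, ha, hb]
    abel
  | smul c i =>
    induction y using basis_induction with
    | add a b ha hb =>
      simp only [map_add, LinearMap.add_apply, ha, hb]
      abel
    | smul d j =>
      induction t using basis_induction with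
      | add a b ha hb =>
        simp only [map_add, ha, hb]
        abel
      | smul e k =>
        simp only [map_smul, LinearMap.smul_apply, jacobi_basis i j k, smul_add]
        simp only [smul_smul]
        congr 2 <;> ring

instance : LieRing W22 where
  add_lie x y t := by simp only [bracket_def, map_add, LinearMap.add_apply]
  lie_add x y t := by simp only [bracket_def, map_add]
  lie_self x := by
    have h : bracketLin x x + bracketLin x x = 0 := by
      nth_rewrite 1 [bracketLin_swap x x]
      exact neg_add_cancel _
    rw [← two_smul ℂ] at h
    exact (smul_eq_zero.mp h).resolve_left two_ne_zero
  leibniz_lie x y t := jacobi x y t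

instance : LieAlgebra ℂ W22 where
  lie_smul c x y := by simp only [bracket_def, map_smul]

lemma lie_L_L (n m : ℤ) : ⁅L n, L m⁆ = ((m : ℂ) - n) • L (m + n) + central n m :=
  bracketLin_L_L n m

lemma lie_L_W (n m : ℤ) : ⁅L n, W m⁆ = ((m : ℂ) - n) • W (m + n) + central n m :=
  bracketLin_L_W n m

lemma lie_W_L (n m : ℤ) : ⁅W n, L m⁆ = -(((n : ℂ) - m) • W (n + m) + central m n) :=
  bracketLin_W_L n m

lemma lie_W_W (n m : ℤ) : ⁅W n, W m⁆ = 0 := bracketLin_W_W n m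

lemma z_lie (x : W22) : ⁅z, x⁆ = 0 := bracketLin_z_left x

lemma lie_z (x : W22) : ⁅x, z⁆ = 0 := bracketLin_z_right x

/-- The spanning set of `W₊`. -/
def plusSet : Set W22 := {x | ∃ n : ℤ, 0 < n ∧ (x = L n ∨ x = W n)}

lemma lie_mem_span_plusSet {x y : W22} (hx : x ∈ plusSet) (hy : y ∈ plusSet) :
    ⁅x, y⁆ ∈ Submodule.span ℂ plusSet := by
  obtain ⟨n, hn, hx⟩ := hx
  obtain ⟨m, hm, hy⟩ := hy
  have hc : ∀ {a b : ℤ}, 0 < a → 0 < b → central a b = 0 := fun {a b} ha hb => by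
    have : ¬ b + a = 0 := by omega
    simp [central, this]
  have hL (k : ℤ) (hk : 0 < k) (c : ℂ) : c • L k ∈ Submodule.span ℂ plusSet :=
    Submodule.smul_mem _ _ (Submodule.subset_span ⟨k, hk, Or.inl rfl⟩)
  have hW (k : ℤ) (hk : 0 < k) (c : ℂ) : c • W k ∈ Submodule.span ℂ plusSet :=
    Submodule.smul_mem _ _ (Submodule.subset_span ⟨k, hk, Or.inr rfl⟩)
  rcases hx with rfl | rfl <;> rcases hy with rfl | rfl
  · rw [lie_L_L, hc hn hm, add_zero]
    exact hL _ (by omega) _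
  · rw [lie_L_W, hc hn hm, add_zero]
    exact hW _ (by omega) _
  · rw [lie_W_L, hc hm hn, add_zero]
    exact neg_mem (hW _ (by omega) _)
  · rw [lie_W_W]
    exact zero_mem _

/-- The subalgebra `W₊` of `W(2,2)`: the linear span of the `L n` and `W n` with `n > 0`. -/
def plus : LieSubalgebra ℂ W22 where
  toSubmodule := Submodule.span ℂ plusSet
  lie_mem' := by
    intro x y hx hy
    change x ∈ Submodule.span ℂ plusSet at hx
    change y ∈ Submodule.span ℂ plusSet at hy
    change ⁅x, y⁆ ∈ Submodule.span ℂ plusSet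
    induction hx, hy using Submodule.span_induction₂ with
    | mem_mem a b ha hb => exact lie_mem_span_plusSet ha hb
    | zero_left b hb => rw [zero_lie]; exact zero_mem _
    | zero_right a ha => rw [lie_zero]; exact zero_mem _
    | add_left a b c _ _ _ h1 h2 => rw [add_lie]; exact add_mem h1 h2
    | add_right a b c _ _ _ h1 h2 => rw [lie_add]; exact add_mem h1 h2
    | smul_left r a b _ _ h => rw [smul_lie]; exact Submodule.smul_mem _ _ h
    | smul_right r a b _ _ h => rw [lie_smul]; exact Submodule.smul_mem _ _ h

/-- `L n` with `n > 0`, as an element of `W₊`. -/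
def plusL (n : ℤ) (hn : 0 < n) : plus := ⟨L n, Submodule.subset_span ⟨n, hn, Or.inl rfl⟩⟩

/-- `W n` with `n > 0`, as an element of `W₊`. -/
def plusW (n : ℤ) (hn : 0 < n) : plus := ⟨W n, Submodule.subset_span ⟨n, hn, Or.inr rfl⟩⟩

/-- A Lie algebra homomorphism `φ : W₊ → ℂ` is non-singular if `φ (L i) φ (W i) ≠ 0` for
`i = 1, 2`. -/
def IsNonsingular (φ : LieAlgebra.LieCharacter ℂ plus) : Prop :=
  φ (plusL 1 one_pos) * φ (plusW 1 one_pos) ≠ 0 ∧ φ (plusL 2 two_pos) * φ (plusW 2 two_pos) ≠ 0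

end

end W22

section InducedModule

variable {A B : Type*} [Ring A] [Ring B] [Algebra ℂ A] [Algebra ℂ B] (f : A →ₐ[ℂ] B)
  (N : Type*) [AddCommGroup N] [Module ℂ N] [Module A N]
  [IsScalarTower ℂ A N]

/-- The balancing relations `b f(a) ⊗ n = b ⊗ a n` in `B ⊗[ℂ] N`. They span a subspace that is
stable under left multiplication by `B`, so it does not matter over which ring the span is taken. -/
def inducedRel : Submodule B (B ⊗[ℂ] N) :=
  Submodule.span B {t | ∃ (b : B) (a : A) (n : N), t = (b * f a) ⊗ₜ[ℂ] n - b ⊗ₜ[ℂ] (a • n)}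

/-- The left `B`-module `B ⊗_A N` induced along `f : A → B` from the left `A`-module `N`: the
quotient of `B ⊗[ℂ] N` by the balancing relations. -/
abbrev InducedModule : Type _ := (B ⊗[ℂ] N) ⧸ inducedRel f N

end InducedModule

namespace W22

noncomputable section

attribute [local instance 100] LieRing.ofAssociativeRing

/-- The homomorphism `U(W₊) → U(W)` of universal enveloping algebras induced by the inclusion of
`W₊`. -/
def envelopingMap : UniversalEnvelopingAlgebra ℂ plus →ₐ[ℂ] UniversalEnvelopingAlgebra ℂ W22 :=
  UniversalEnvelopingAlgebra.lift ℂ ((UniversalEnvelopingAlgebra.ι ℂ).comp plus.incl)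

/-- The one-dimensional space `ℂ_φ`. -/
def OneDim (_φ : LieAlgebra.LieCharacter ℂ plus) : Type := ℂ

variable (φ : LieAlgebra.LieCharacter ℂ plus)

instance : AddCommGroup (OneDim φ) := inferInstanceAs (AddCommGroup ℂ)

instance : Module ℂ (OneDim φ) := inferInstanceAs (Module ℂ ℂ)

/-- `U(W₊)` acts on `ℂ_φ` through the algebra homomorphism `U(W₊) → ℂ` that extends `φ`. -/
instance : Module (UniversalEnvelopingAlgebra ℂ plus) (OneDim φ) :=
  Module.compHom ℂ (UniversalEnvelopingAlgebra.lift ℂ φ).toRingHom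

lemma smul_oneDim_def (a : UniversalEnvelopingAlgebra ℂ plus) (c : ℂ) :
    a • (show OneDim φ from c) =
      (show OneDim φ from UniversalEnvelopingAlgebra.lift ℂ φ a * c) := rfl

instance : IsScalarTower ℂ (UniversalEnvelopingAlgebra ℂ plus) (OneDim φ) where
  smul_assoc c a n := by
    change UniversalEnvelopingAlgebra.lift ℂ φ (c • a) * (show ℂ from n) =
      c * (UniversalEnvelopingAlgebra.lift ℂ φ a * (show ℂ from n))
    rw [map_smul, smul_eq_mul, mul_assoc]

/-- The universal Whittaker module `M_φ = U(W) ⊗_{U(W₊)} ℂ_φ`. -/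
def M : Type := InducedModule envelopingMap (OneDim φ)

instance : AddCommGroup (M φ) :=
  inferInstanceAs (AddCommGroup (InducedModule envelopingMap (OneDim φ)))

instance : Module (UniversalEnvelopingAlgebra ℂ W22) (M φ) :=
  inferInstanceAs (Module _ (InducedModule envelopingMap (OneDim φ)))

instance : Module ℂ (M φ) :=
  inferInstanceAs (Module ℂ (InducedModule envelopingMap (OneDim φ)))

instance : IsScalarTower ℂ (UniversalEnvelopingAlgebra ℂ W22) (M φ) :=
  inferInstanceAs (IsScalarTower ℂ _ (InducedModule envelopingMap (OneDim φ)))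

/-- `W(2,2)` acts on `M_φ` through `U(W)`. -/
instance : LieRingModule W22 (M φ) where
  bracket x m := UniversalEnvelopingAlgebra.ι ℂ x • m
  add_lie x y m := by simp only [map_add, add_smul]
  lie_add x m n := smul_add _ m n
  leibniz_lie x y m := by
    simp only [LieHom.map_lie, LieRing.of_associative_ring_bracket, sub_smul, mul_smul]
    abel

lemma lie_M_def (x : W22) (m : M φ) : ⁅x, m⁆ = UniversalEnvelopingAlgebra.ι ℂ x • m := rfl

instance : LieModule ℂ W22 (M φ) where
  smul_lie c x m := by simp only [lie_M_def, map_smul, smul_assoc]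
  lie_smul c x m := by simp only [lie_M_def]; exact smul_comm _ _ _

variable (ξ : ℂ)

/-- The submodule `(z - ξ) M_φ` of `M_φ`. -/
def zSub : LieSubmodule ℂ W22 (M φ) where
  toSubmodule := LinearMap.range (LieModule.toEnd ℂ W22 (M φ) z - ξ • LinearMap.id)
  lie_mem := by
    rintro x _ ⟨m, rfl⟩
    refine ⟨⁅x, m⁆, ?_⟩
    simp only [LinearMap.sub_apply, LieModule.toEnd_apply_apply, LinearMap.smul_apply,
      LinearMap.id_apply, lie_sub, lie_smul, leibniz_lie x z m, lie_z, zero_lie, zero_add]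

lemma mem_zSub {v : M φ} : v ∈ zSub φ ξ ↔ ∃ m : M φ, ⁅z, m⁆ - ξ • m = v := Iff.rfl

/-- The module `L_{φ,ξ} = M_φ / (z - ξ) M_φ`. -/
abbrev LMod : Type := M φ ⧸ zSub φ ξ

variable (V : Type*) [AddCommGroup V] [Module ℂ V] [LieRingModule W22 V]

variable {V} in
/-- `v` is a Whittaker vector of type `φ`: `x v = φ(x) v` for all `x ∈ W₊`. -/
def IsWhittakerVector (v : V) : Prop := ∀ x : plus, ⁅(x : W22), v⁆ = φ x • v

/-- `V` is a Whittaker module of type `φ`: it is generated by a Whittaker vector of type `φ`. -/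
def IsWhittakerModule : Prop :=
  ∃ v : V, IsWhittakerVector φ v ∧ LieSubmodule.lieSpan ℂ W22 {v} = (⊤ : LieSubmodule ℂ W22 V)

/-- `z` acts on `V` as the scalar `ξ`. -/
def HasCentralCharacter : Prop := ∀ v : V, ⁅z, v⁆ = ξ • v

end

end W22

/-! The module should have the underlying space of polynomials in the symbols `W (-k)`, `L (-k)`
with `k ≥ 0`, a sorted monomial standing for the corresponding ordered product applied to the
Whittaker vector. That such a module exists, so that no collapse takes place, is a
Poincaré–Birkhoff–Witt statement. It is proved directly for a Lie algebra with basis `ι ⊕ κ` and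
scalars `χ` on the `κ` part: straightening forces the action on polynomials, `act_lie` shows that it
respects brackets, and `toModule_act` maps it to any module containing a vector on which the `κ`
part acts by `χ`.

Simplicity of the model comes from two descents inside a nonzero submodule. Filter polynomials by
the number of factors `L (-k)`. Modulo two filtration steps, `W n - φ (W n)` acts as a derivation
sending `L (-k)` to a multiple of the symbol of `W (n - k)`, up to a central scalar. Since `φ` kills
`W m` for `m ≥ 3`, taking `n = K + 2` with `K` the largest `L`-index in the leading part leaves only
a nonzero multiple of the partial derivative in `L (-K)`; the factor is nonzero because `φ (W 2) ≠
0`. Repeating this yields a nonzero polynomial in the `W (-k)` alone (`exists_lower_filt`). There `L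
(K + 2) - φ (L (K + 2))` acts exactly as a nonzero multiple of the derivative in `W (-K)`, so the
degree drops until a constant remains (`one_mem_of_mem_filt_one`), and `1` generates.

Any nontrivial module generated by a Whittaker vector on which `z` acts by `ξ` is then a quotient of
a simple module, hence isomorphic to the model (`nonempty_model_equiv`). This applies to `L_{φ,ξ}`,
whose generator survives because it maps to `1` in the model. It also applies to an arbitrary simple
Whittaker module once `z` is known to be scalar there, which is Dixmier's form of Schur's lemma: the
dimension is countable and `ℂ` is not (`exists_hasCentralCharacter`). Different scalars are told
apart by the action of `z`. -/

namespace InducedPoly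

open MvPolynomial

noncomputable section

variable {K ι κ g : Type*} [Field K] [LinearOrder ι] [LieRing g] [LieAlgebra K g]

/-! ### Sorted monomials and the degree filtration -/

/-- The monomial attached to a multiset of variables. -/
def mono (K : Type*) [Field K] (A : Multiset ι) : MvPolynomial ι K := (A.map X).prod

omit [LinearOrder ι] in
@[simp] lemma mono_zero : mono K (0 : Multiset ι) = 1 := by simp [mono]

omit [LinearOrder ι] in
lemma mono_cons (i : ι) (A : Multiset ι) : mono K (i ::ₘ A) = X i * mono K A := by simp [mono]

lemma mono_eq_monomial (A : Multiset ι) :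
    mono K A = monomial (Multiset.toFinsupp A) 1 := by
  induction A using Multiset.induction_on with
  | empty => simp
  | cons i A ih =>
    rw [mono_cons, ih, ← Multiset.singleton_add, map_add, Multiset.toFinsupp_singleton,
      X, monomial_mul, one_mul]

/-- The monomial basis of a polynomial ring, indexed by multisets. -/
def monoBasis (K ι : Type*) [Field K] [LinearOrder ι] :
    Module.Basis (Multiset ι) K (MvPolynomial ι K) :=
  (basisMonomials ι K).reindex Multiset.toFinsupp.toEquiv.symm

@[simp] lemma monoBasis_apply (A : Multiset ι) : monoBasis K ι A = mono K A := by
  simp [monoBasis, mono_eq_monomial]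

/-- A nonempty multiset in a linear order is its minimum together with the rest. -/
lemma multiset_min_induction {p : Multiset ι → Prop} (A : Multiset ι) (zero : p 0)
    (cons : ∀ j B, (∀ a ∈ B, j ≤ a) → p B → p (j ::ₘ B)) : p A := by
  obtain ⟨l, hs, rfl⟩ : ∃ l : List ι, l.Pairwise (· ≤ ·) ∧ (l : Multiset ι) = A :=
    ⟨A.sort (· ≤ ·), A.pairwise_sort (· ≤ ·), A.sort_eq (· ≤ ·)⟩
  induction l with
  | nil => exact zero
  | cons j l ih =>
    rw [List.pairwise_cons] at hs
    exact cons j l (fun a ha => hs.1 a (by simpa using ha)) (ih hs.2)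

lemma multiset_eq_zero_or_min (A : Multiset ι) :
    A = 0 ∨ ∃ j B, (∀ a ∈ B, j ≤ a) ∧ A = j ::ₘ B := by
  induction A using multiset_min_induction with
  | zero => exact Or.inl rfl
  | cons j B h _ => exact Or.inr ⟨j, B, h, rfl⟩

/-- Polynomials of degree at most `d`. -/
def degLE (K ι : Type*) [Field K] [LinearOrder ι] (d : ℕ) : Submodule K (MvPolynomial ι K) :=
  Submodule.span K {p | ∃ A : Multiset ι, A.card ≤ d ∧ p = mono K A}

lemma mono_mem_degLE {A : Multiset ι} {d : ℕ} (h : A.card ≤ d) : mono K A ∈ degLE K ι d :=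
  Submodule.subset_span ⟨A, h, rfl⟩

lemma degLE_mono {d e : ℕ} (h : d ≤ e) : degLE K ι d ≤ degLE K ι e :=
  Submodule.span_mono fun _ ⟨A, hA, hp⟩ => ⟨A, hA.trans h, hp⟩

lemma map_mem_of_degLE {N : Type*} [AddCommGroup N] [Module K N] {d : ℕ}
    (f : MvPolynomial ι K →ₗ[K] N) (S : Submodule K N)
    (h : ∀ A : Multiset ι, A.card ≤ d → f (mono K A) ∈ S) {p : MvPolynomial ι K}
    (hp : p ∈ degLE K ι d) : f p ∈ S := by
  have : degLE K ι d ≤ S.comap f := Submodule.span_le.2 fun _ ⟨A, hA, hp⟩ => hp ▸ h A hA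
  exact this hp

lemma eq_on_degLE {N : Type*} [AddCommGroup N] [Module K N] {d : ℕ}
    (f f' : MvPolynomial ι K →ₗ[K] N)
    (h : ∀ A : Multiset ι, A.card ≤ d → f (mono K A) = f' (mono K A)) {p : MvPolynomial ι K}
    (hp : p ∈ degLE K ι d) : f p = f' p := by
  have := map_mem_of_degLE (f - f') ⊥ (fun A hA => by simp [h A hA]) hp
  simpa [sub_eq_zero] using this

lemma map_mem_of_basis {J N : Type*} [AddCommGroup N] [Module K N] (b : Module.Basis J K g)
    (f : g →ₗ[K] N) (S : Submodule K N) (h : ∀ j, f (b j) ∈ S) (y : g) : f y ∈ S := by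
  have : (⊤ : Submodule K g) ≤ S.comap f := by
    rw [← b.span_eq]
    exact Submodule.span_le.2 fun _ ⟨j, hj⟩ => hj ▸ h j
  exact this trivial

/-! ### The straightening action on polynomials -/

variable (b : Module.Basis (ι ⊕ κ) K g) (χ : κ → K)

/-- The leading symbol of an element of the Lie algebra. -/
def sym : g →ₗ[K] MvPolynomial ι K := b.constr K (Sum.elim X 0)

omit [LinearOrder ι] in
@[simp] lemma sym_inl (i : ι) : sym b (b (.inl i)) = X i := by simp [sym]

omit [LinearOrder ι] in
@[simp] lemma sym_inr (a : κ) : sym b (b (.inr a)) = 0 := by simp [sym]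

lemma sym_mul_mem (y : g) {d : ℕ} {p : MvPolynomial ι K} (hp : p ∈ degLE K ι d) :
    sym b y * p ∈ degLE K ι (d + 1) := by
  refine map_mem_of_degLE (LinearMap.mulLeft K (sym b y)) _ (fun A hA => ?_) hp
  refine map_mem_of_basis b ((LinearMap.mulRight K (mono K A)).comp (sym b)) _ (fun j => ?_) y
  cases j with
  | inl i => simpa [← mono_cons] using mono_mem_degLE (by simpa using hA)
  | inr a => simp

/-- Multiplication by the leading symbol. -/
def symMul : g →ₗ[K] MvPolynomial ι K →ₗ[K] MvPolynomial ι K := (LinearMap.mul K _).comp (sym b)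

omit [LinearOrder ι] in
@[simp] lemma symMul_apply (y : g) (p : MvPolynomial ι K) : symMul b y p = sym b y * p := rfl

open Classical in
/-- The part of lower degree of the action on a sorted monomial, given an approximation `R` to it
in lower degrees. -/
def lowerStep (R : g →ₗ[K] MvPolynomial ι K →ₗ[K] MvPolynomial ι K) (x : ι ⊕ κ) :
    List ι → MvPolynomial ι K
  | [] => C (Sum.elim 0 χ x)
  | j :: l =>
    -- In this case putting `x` in front keeps the word sorted, so there is no correction. Otherwise
    -- `x (j l) = j (x l) + [x, j] l`, and the term `X j * sym x * l` is left out since it is the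
    -- leading part.
    if ∃ i, x = .inl i ∧ i ≤ j then 0
    else (symMul b + R) (b (.inl j)) (R (b x) (mono K (l : Multiset ι))) +
      (symMul b + R) ⁅b x, b (.inl j)⁆ (mono K (l : Multiset ι))

/-- Approximations to the part of lower degree of the action. -/
def lowerApprox : ℕ → g →ₗ[K] MvPolynomial ι K →ₗ[K] MvPolynomial ι K
  | 0 => 0
  | n + 1 => b.constr K fun x => (monoBasis K ι).constr K fun A =>
      lowerStep b χ (lowerApprox n) x A.sort

lemma lowerApprox_succ (n : ℕ) (x : ι ⊕ κ) (A : Multiset ι) :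
    lowerApprox b χ (n + 1) (b x) (mono K A) = lowerStep b χ (lowerApprox b χ n) x A.sort := by
  rw [lowerApprox, Module.Basis.constr_basis, ← monoBasis_apply, Module.Basis.constr_basis]

/-- Removing the smallest letter lowers the degree by one, and each correction term contains at most
one further multiplication by a symbol, which restores it. -/
lemma lowerApprox_mem (n : ℕ) : ∀ (y : g) {d : ℕ} {p : MvPolynomial ι K}, p ∈ degLE K ι d →
    lowerApprox b χ n y p ∈ degLE K ι d := by
  induction n with
  | zero => intro y d p _; simp [lowerApprox]
  | succ n ih =>
    intro y d p hp
    refine map_mem_of_degLE _ _ (fun A hA => ?_) hp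
    refine map_mem_of_basis b ((lowerApprox b χ (n + 1)).flip (mono K A)) _ (fun x => ?_) y
    rw [LinearMap.flip_apply, lowerApprox_succ]
    rcases multiset_eq_zero_or_min A with rfl | ⟨j, B, hj, rfl⟩
    · rw [Multiset.sort_zero, lowerStep, C_eq_smul_one, ← mono_zero]
      exact Submodule.smul_mem _ _ (mono_mem_degLE (by simp))
    · rw [Multiset.sort_cons _ _ _ hj, lowerStep, Multiset.sort_eq]
      have hB : B.card + 1 ≤ d := by simpa using hA
      split_ifs
      · exact zero_mem _
      · have h1 : ∀ (y : g) p, p ∈ degLE K ι B.card →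
            (symMul b + lowerApprox b χ n) y p ∈ degLE K ι d := fun y p hp =>
          degLE_mono hB (add_mem (sym_mul_mem b y hp) (degLE_mono (Nat.le_succ _) (ih y hp)))
        exact add_mem (h1 _ _ (ih _ (mono_mem_degLE le_rfl))) (h1 _ _ (mono_mem_degLE le_rfl))

/-- The recursion for a monomial calls the previous approximation only in strictly smaller degree,
so the `n`-th approximation is final below degree `n`. -/
lemma lowerApprox_stable (n : ℕ) : ∀ (y : g) {d : ℕ} {p : MvPolynomial ι K}, d < n →
    p ∈ degLE K ι d → lowerApprox b χ (n + 1) y p = lowerApprox b χ n y p := by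
  induction n with
  | zero => intro y d p h; omega
  | succ n ih =>
    intro y d p h hp
    refine eq_on_degLE _ _ (fun A hA => ?_) hp
    have := map_mem_of_basis b ((lowerApprox b χ (n + 2) - lowerApprox b χ (n + 1)).flip (mono K A))
      ⊥ (fun x => ?_) y
    · simpa [sub_eq_zero] using this
    rw [Submodule.mem_bot, LinearMap.flip_apply, LinearMap.sub_apply, LinearMap.sub_apply,
      lowerApprox_succ, lowerApprox_succ, sub_eq_zero]
    rcases multiset_eq_zero_or_min A with rfl | ⟨j, B, hj, rfl⟩
    · simp [lowerStep]
    · rw [Multiset.sort_cons _ _ _ hj, lowerStep, lowerStep, Multiset.sort_eq]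
      have hB : B.card < n := by
        have : B.card + 1 ≤ d := by simpa using hA
        omega
      have h1 : ∀ (y : g) p, p ∈ degLE K ι B.card →
          lowerApprox b χ (n + 1) y p = lowerApprox b χ n y p := fun y p hp => ih y hB hp
      have hm := mono_mem_degLE (K := K) (le_refl B.card)
      split_ifs
      · rfl
      · simp only [LinearMap.add_apply, h1 _ _ hm, h1 _ _ (lowerApprox_mem b χ n _ hm)]

/-- The part of lower degree of the action. -/
def lower : g →ₗ[K] MvPolynomial ι K →ₗ[K] MvPolynomial ι K :=
  b.constr K fun x => (monoBasis K ι).constr K fun A =>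
    lowerApprox b χ (A.card + 1) (b x) (mono K A)

lemma lowerApprox_eq_of_lt (y : g) {A : Multiset ι} {n : ℕ} (h : A.card < n) :
    lowerApprox b χ n y (mono K A) = lowerApprox b χ (A.card + 1) y (mono K A) := by
  induction n, h using Nat.le_induction with
  | base => rfl
  | succ n h ih => rw [lowerApprox_stable b χ n y h (mono_mem_degLE le_rfl), ih]

lemma lower_mono (y : g) (A : Multiset ι) :
    lower b χ y (mono K A) = lowerApprox b χ (A.card + 1) y (mono K A) := by
  have : (lower b χ).flip (mono K A) = (lowerApprox b χ (A.card + 1)).flip (mono K A) :=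
    b.ext fun x => by
      rw [LinearMap.flip_apply, LinearMap.flip_apply, lower, Module.Basis.constr_basis]
      conv_lhs => rw [← monoBasis_apply, Module.Basis.constr_basis]
  exact congrArg (fun f => f y) this

lemma lowerApprox_eq_lower (y : g) {d n : ℕ} (h : d < n) {p : MvPolynomial ι K}
    (hp : p ∈ degLE K ι d) : lowerApprox b χ n y p = lower b χ y p :=
  eq_on_degLE _ _ (fun A hA => by
    rw [lower_mono, lowerApprox_eq_of_lt b χ y (hA.trans_lt h)]) hp

lemma lower_mem (y : g) {d : ℕ} {p : MvPolynomial ι K} (hp : p ∈ degLE K ι d) :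
    lower b χ y p ∈ degLE K ι d := by
  rw [← lowerApprox_eq_lower b χ y d.lt_succ_self hp]
  exact lowerApprox_mem b χ _ y hp

/-- The action of the Lie algebra on polynomials. -/
def act : g →ₗ[K] MvPolynomial ι K →ₗ[K] MvPolynomial ι K := symMul b + lower b χ

lemma act_apply (y : g) (p : MvPolynomial ι K) : act b χ y p = sym b y * p + lower b χ y p := rfl

lemma act_inr_one (a : κ) : act b χ (b (.inr a)) 1 = C (χ a) := by
  rw [act_apply, ← mono_zero, lower_mono, lowerApprox_succ]
  simp [lowerStep]

lemma act_inl_mono (i : ι) (A : Multiset ι) (h : ∀ a ∈ A, i ≤ a) :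
    act b χ (b (.inl i)) (mono K A) = X i * mono K A := by
  rw [act_apply, lower_mono, lowerApprox_succ, sym_inl, add_eq_left]
  rcases multiset_eq_zero_or_min A with rfl | ⟨j, B, hj, rfl⟩
  · simp [lowerStep]
  · rw [Multiset.sort_cons _ _ _ hj, lowerStep, if_pos ⟨i, rfl, h j (by simp)⟩]

/-- The symbol of `x` is either zero or a variable larger than `j`, so `j` is still the smallest
letter and acts by plain multiplication. -/
lemma act_sym_mul (j : ι) (B : Multiset ι) (hj : ∀ a ∈ B, j ≤ a) (x : ι ⊕ κ)
    (hx : ¬ ∃ i, x = .inl i ∧ i ≤ j) :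
    act b χ (b (.inl j)) (sym b (b x) * mono K B) = X j * (sym b (b x) * mono K B) := by
  cases x with
  | inr a => simp
  | inl i =>
    rw [sym_inl, ← mono_cons, act_inl_mono]
    intro a ha
    rcases Multiset.mem_cons.1 ha with rfl | ha
    · exact le_of_not_ge fun h => hx ⟨_, rfl, h⟩
    · exact hj a ha

/-- This is the recursion of `lowerStep` read as the rule `x j B = j x B + [x, j] B`; stability
allows the approximations to be replaced by the action itself. -/
lemma act_mono_cons (j : ι) (B : Multiset ι) (hj : ∀ a ∈ B, j ≤ a) (x : ι ⊕ κ)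
    (hx : ¬ ∃ i, x = .inl i ∧ i ≤ j) :
    act b χ (b x) (mono K (j ::ₘ B)) = act b χ (b (.inl j)) (act b χ (b x) (mono K B)) +
      act b χ ⁅b x, b (.inl j)⁆ (mono K B) := by
  have hm := mono_mem_degLE (K := K) (le_refl B.card)
  have hl (y : g) {p : MvPolynomial ι K} (hp : p ∈ degLE K ι B.card) :
    lowerApprox b χ (B.card + 1) y p = lower b χ y p :=
    lowerApprox_eq_lower b χ y (Nat.lt_succ_self _) hp
  rw [act_apply b χ (b x) (mono K B), map_add, act_sym_mul b χ j B hj x hx, act_apply b χ (b x),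
    lower_mono, lowerApprox_succ, Multiset.sort_cons _ _ _ hj, lowerStep, if_neg hx,
    Multiset.sort_eq, mono_cons, Multiset.card_cons]
  simp only [LinearMap.add_apply, hl _ hm, hl _ (lower_mem b χ _ hm), symMul_apply, act_apply]
  ring

/-! ### The action respects brackets -/

/-- The defect of the action from being a representation. -/
def defect (x y : g) : MvPolynomial ι K →ₗ[K] MvPolynomial ι K :=
  (act b χ x).comp (act b χ y) - (act b χ y).comp (act b χ x) - act b χ ⁅x, y⁆

lemma defect_apply (x y : g) (p : MvPolynomial ι K) : defect b χ x y p =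
    act b χ x (act b χ y p) - act b χ y (act b χ x p) - act b χ ⁅x, y⁆ p := rfl

lemma defect_swap (x y : g) (p : MvPolynomial ι K) : defect b χ x y p = - defect b χ y x p := by
  rw [defect_apply, defect_apply, ← lie_skew x y, map_neg, LinearMap.neg_apply]
  abel

lemma defect_eq_zero_of_basis_left {p : MvPolynomial ι K} {y : g}
    (h : ∀ i, defect b χ (b i) y p = 0) (x : g) : defect b χ x y p = 0 := by
  let D : g →ₗ[K] MvPolynomial ι K :=
    { toFun := fun x => defect b χ x y p
      map_add' := fun x x' => by
        simp only [defect_apply, add_lie, map_add, LinearMap.add_apply]; abel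
      map_smul' := fun c x => by
        simp only [defect_apply, smul_lie, map_smul, LinearMap.smul_apply, smul_sub,
          RingHom.id_apply] }
  exact (Submodule.mem_bot K).1 (map_mem_of_basis b D ⊥ h x)

lemma defect_eq_zero_of_basis {p : MvPolynomial ι K}
    (h : ∀ i j, defect b χ (b i) (b j) p = 0) (x y : g) : defect b χ x y p = 0 :=
  defect_eq_zero_of_basis_left b χ (fun i => by
    rw [defect_swap, defect_eq_zero_of_basis_left b χ (fun j => h j i), neg_zero]) x

/-- When `x` is not a variable below `j`, this is the defining recursion. When it is, the roles of
`x` and `j` are exchanged by antisymmetry. -/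
lemma defect_inl_of_le (j : ι) (A : Multiset ι) (hj : ∀ a ∈ A, j ≤ a) (x : ι ⊕ κ) :
    defect b χ (b x) (b (.inl j)) (mono K A) = 0 := by
  have key (j : ι) (hj : ∀ a ∈ A, j ≤ a) (x : ι ⊕ κ) (hx : ¬ ∃ i, x = .inl i ∧ i ≤ j) :
      defect b χ (b x) (b (.inl j)) (mono K A) = 0 := by
    rw [defect_apply, act_inl_mono b χ j A hj, ← mono_cons, act_mono_cons b χ j A hj x hx]
    abel
  by_cases hx : ∃ i, x = .inl i ∧ i ≤ j
  · obtain ⟨i, rfl, hi⟩ := hx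
    rcases hi.eq_or_lt with rfl | hi
    · simp [defect_apply]
    · rw [defect_swap, key i (fun a ha => hi.le.trans (hj a ha)), neg_zero]
      rintro ⟨k, hk, hk'⟩
      cases hk
      exact absurd hi (not_lt.2 hk')
  · exact key j hj x hx

variable (h0 : ∀ a c : κ, act b χ ⁅b (.inr a), b (.inr c)⁆ 1 = 0)

include h0 in
-- As in the classical proof of Poincaré–Birkhoff–Witt, the only case not built into the definition
-- has both `x` and `y` out of order with the smallest letter `k`. There the Jacobi identity reduces
-- the claim to smaller degree.
lemma defect_eq_zero_aux (d : ℕ) : ∀ (x y : g) {p : MvPolynomial ι K}, p ∈ degLE K ι d →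
    defect b χ x y p = 0 := by
  have red : ∀ d, (∀ (A : Multiset ι), A.card ≤ d → ∀ x y, defect b χ (b x) (b y) (mono K A) = 0) →
      ∀ (x y : g) {p : MvPolynomial ι K}, p ∈ degLE K ι d → defect b χ x y p = 0 :=
    fun d h x y p hp => eq_on_degLE (defect b χ x y) 0
      (fun A hA => defect_eq_zero_of_basis b χ (h A hA) x y) hp
  have hz (x y : ι ⊕ κ) : defect b χ (b x) (b y) (mono K 0) = 0 := by
    rcases y with j | c
    · exact defect_inl_of_le b χ j 0 (by simp) x
    rcases x with i | a
    · rw [defect_swap, defect_inl_of_le b χ i 0 (by simp), neg_zero]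
    -- Two elements of the `κ` part act on `1` by scalars, which commute, and `h0` says that their
    -- bracket kills `1`.
    · rw [defect_apply, mono_zero, h0, act_inr_one, act_inr_one, C_eq_smul_one, C_eq_smul_one,
        map_smul, map_smul, act_inr_one, act_inr_one, C_eq_smul_one, C_eq_smul_one, smul_comm]
      simp
  induction d with
  | zero =>
    refine red 0 fun A hA x y => ?_
    obtain rfl : A = 0 := by simpa using hA
    exact hz x y
  | succ d ih =>
    refine red _ fun A hA x y => ?_
    rcases multiset_eq_zero_or_min A with rfl | ⟨k, B, hk, rfl⟩
    · exact hz x y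
    have hkk : ∀ a ∈ k ::ₘ B, k ≤ a := fun a ha => by
      rcases Multiset.mem_cons.1 ha with rfl | ha
      exacts [le_rfl, hk a ha]
    have hB : mono K B ∈ degLE K ι d := mono_mem_degLE (by simpa using hA)
    by_cases hx : ∃ i, x = .inl i ∧ i ≤ k
    · obtain ⟨i, rfl, hi⟩ := hx
      rw [defect_swap, defect_inl_of_le b χ i _ (fun a ha => hi.trans (hkk a ha)), neg_zero]
    by_cases hy : ∃ i, y = .inl i ∧ i ≤ k
    · obtain ⟨i, rfl, hi⟩ := hy
      rw [defect_inl_of_le b χ i _ (fun a ha => hi.trans (hkk a ha))]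
    have hk1 (x : g) : defect b χ x (b (.inl k)) (mono K B) = 0 :=
      defect_eq_zero_of_basis_left b χ (defect_inl_of_le b χ k B hk) x
    -- Here `y B` may have too large a degree for the induction hypothesis, but its leading part is
    -- zero or a monomial with all letters at least `k`, which `defect_inl_of_le` covers.
    have hk2 (x y : ι ⊕ κ) (hy : ¬ ∃ i, y = .inl i ∧ i ≤ k) :
        defect b χ (b x) (b (.inl k)) (act b χ (b y) (mono K B)) = 0 := by
      rw [act_apply, map_add, ih _ _ (lower_mem b χ _ hB), add_zero]
      cases y with
      | inr a => simp
      | inl i =>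
        rw [sym_inl, ← mono_cons]
        refine defect_inl_of_le b χ k _ (fun a ha => ?_) x
        rcases Multiset.mem_cons.1 ha with rfl | ha
        · exact le_of_not_ge fun h => hy ⟨_, rfl, h⟩
        · exact hk a ha
    have e (x y : g) (p) (h : defect b χ x y p = 0) :
        act b χ x (act b χ y p) = act b χ y (act b χ x p) + act b χ ⁅x, y⁆ p := by
      rw [defect_apply, sub_sub, sub_eq_zero] at h
      exact h
    have main (x y : ι ⊕ κ) (hy : ¬ ∃ i, y = .inl i ∧ i ≤ k) :
        act b χ (b x) (act b χ (b y) (mono K (k ::ₘ B))) =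
          act b χ (b (.inl k)) (act b χ (b x) (act b χ (b y) (mono K B))) +
          act b χ ⁅b x, b (.inl k)⁆ (act b χ (b y) (mono K B)) +
          (act b χ ⁅b y, b (.inl k)⁆ (act b χ (b x) (mono K B)) +
          act b χ ⁅b x, ⁅b y, b (.inl k)⁆⁆ (mono K B)) := by
      rw [act_mono_cons b χ k B hk y hy, map_add, e _ _ _ (hk2 x y hy),
        e (b x) ⁅b y, b (.inl k)⁆ _ (ih _ _ hB)]
    -- On antisymmetrizing, the mixed terms cancel. What is left is `k [x, y] B + [[x, y], k] B`, by
    -- Jacobi, and this equals `[x, y] k B`.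
    rw [defect_apply, main x y hy, main y x hx, mono_cons, ← act_inl_mono b χ k B hk,
      e _ _ _ (hk1 _), e _ _ _ (ih (b x) (b y) hB), lie_lie (b x) (b y), map_sub, map_add,
      LinearMap.sub_apply]
    abel

include h0 in
lemma act_lie (x y : g) (p : MvPolynomial ι K) : act b χ ⁅x, y⁆ p =
    act b χ x (act b χ y p) - act b χ y (act b χ x p) := by
  have h : defect b χ x y = 0 := (monoBasis K ι).ext fun A => by
    rw [monoBasis_apply]
    exact defect_eq_zero_aux b χ h0 A.card x y (mono_mem_degLE le_rfl)
  have := congrArg (fun f => f p) h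
  rw [defect_apply] at this
  exact (sub_eq_zero.1 this).symm

/-! ### Universal property of the polynomial module -/

/-- The linear map to a `g`-module that sends sorted monomials to the corresponding products
applied to a given vector. -/
def toModule {V : Type*} [AddCommGroup V] [Module K V] [LieRingModule g V]
    (v : V) : MvPolynomial ι K →ₗ[K] V :=
  (monoBasis K ι).constr K fun A => A.sort.foldr (fun i w => ⁅b (.inl i), w⁆) v

section
variable {V : Type*} [AddCommGroup V] [Module K V] [LieRingModule g V] (v : V)

lemma toModule_one : toModule b v 1 = v := by
  rw [← mono_zero, ← monoBasis_apply, toModule, Module.Basis.constr_basis]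
  simp

lemma toModule_mono_cons (j : ι) (B : Multiset ι) (hj : ∀ a ∈ B, j ≤ a) :
    toModule b v (mono K (j ::ₘ B)) = ⁅b (.inl j), toModule b v (mono K B)⁆ := by
  rw [← monoBasis_apply, ← monoBasis_apply, toModule, Module.Basis.constr_basis,
    Module.Basis.constr_basis, Multiset.sort_cons _ _ _ hj, List.foldr_cons]

variable [LieModule K g V] (hv : ∀ a, ⁅b (.inr a), v⁆ = χ a • v)

include hv in
-- The straightening rule that defines the action is an identity in every module, so equivariance
-- follows by the same recursion on degree.
lemma toModule_act_aux (d : ℕ) : ∀ (y : g) {p : MvPolynomial ι K}, p ∈ degLE K ι d →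
    toModule b v (act b χ y p) = ⁅y, toModule b v p⁆ := by
  induction d using Nat.strong_induction_on with
  | _ d ih =>
  intro y p hp
  refine eq_on_degLE ((toModule b v).comp (act b χ y))
    ((LieModule.toEnd K g V y).comp (toModule b v)) (fun A hA => ?_) hp
  let f : g →ₗ[K] V :=
    { toFun := fun y => ⁅y, toModule b v (mono K A)⁆
      map_add' := fun x y => add_lie x y _
      map_smul' := fun c x => smul_lie c x _ }
  have := map_mem_of_basis b ((toModule b v).comp ((act b χ).flip (mono K A)) - f) ⊥
    (fun x => ?_) y
  · exact sub_eq_zero.1 ((Submodule.mem_bot K).1 this)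
  change toModule b v (act b χ (b x) (mono K A)) - ⁅b x, toModule b v (mono K A)⁆ = 0
  rw [sub_eq_zero]
  have hle (i : ι) (B : Multiset ι) (hi : ∀ a ∈ B, i ≤ a) :
      toModule b v (act b χ (b (.inl i)) (mono K B)) = ⁅b (.inl i), toModule b v (mono K B)⁆ := by
    rw [act_inl_mono b χ i B hi, ← mono_cons, toModule_mono_cons b v i B hi]
  rcases multiset_eq_zero_or_min A with rfl | ⟨j, B, hj, rfl⟩
  · cases x with
    | inl i => exact hle i 0 (by simp)
    | inr a =>
      rw [mono_zero, act_inr_one, C_eq_smul_one, map_smul, toModule_one, hv]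
  · by_cases hx : ∃ i, x = .inl i ∧ i ≤ j
    · obtain ⟨i, rfl, hi⟩ := hx
      refine hle i _ fun a ha => ?_
      rcases Multiset.mem_cons.1 ha with rfl | ha
      exacts [hi, hi.trans (hj a ha)]
    have hd : B.card < d := by
      have : B.card + 1 ≤ d := by simpa using hA
      omega
    have hB := mono_mem_degLE (K := K) (le_refl B.card)
    have h1 : toModule b v (act b χ (b (.inl j)) (act b χ (b x) (mono K B))) =
        ⁅b (.inl j), toModule b v (act b χ (b x) (mono K B))⁆ := by
      rw [act_apply b χ (b x), map_add, map_add, map_add, lie_add,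
        ih _ hd _ (lower_mem b χ _ hB)]
      congr 1
      cases x with
      | inr a => simp
      | inl i =>
        rw [sym_inl, ← mono_cons]
        refine hle j _ fun a ha => ?_
        rcases Multiset.mem_cons.1 ha with rfl | ha
        · exact le_of_not_ge fun h => hx ⟨_, rfl, h⟩
        · exact hj a ha
    rw [act_mono_cons b χ j B hj x hx, map_add, h1, ih _ hd _ hB, ih _ hd _ hB,
      toModule_mono_cons b v j B hj, lie_lie]
    abel

include hv in
lemma toModule_act (y : g) (p : MvPolynomial ι K) :
    toModule b v (act b χ y p) = ⁅y, toModule b v p⁆ := by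
  have : (toModule b v).comp (act b χ y) = (LieModule.toEnd K g V y).comp (toModule b v) :=
    (monoBasis K ι).ext fun A => by
      rw [monoBasis_apply]
      exact toModule_act_aux b χ v hv A.card y (mono_mem_degLE le_rfl)
  exact congrArg (fun f => f p) this

end

end

end InducedPoly

/-! ### The triangular basis and the polynomial model of `W(2,2)` -/

namespace W22

open MvPolynomial InducedPoly

noncomputable section

/-- The variables of the polynomial model: `inlₗ k` stands for `W (-k)` and `inrₗ k` for
`L (-k)`. -/
abbrev Var : Type := ℕ ⊕ₗ ℕ

/-- Labels of the basis of `W₊ ⊕ ℂ z`: `none` stands for `z`, `inl k` for `W (k + 1)` and `inr k`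
for `L (k + 1)`. -/
abbrev PosIndex : Type := Option (ℕ ⊕ ℕ)

/-- The label of the basis element of `W(2,2)` that belongs to a label of the triangular basis. -/
def toIndex : Var ⊕ PosIndex → W22Index
  | .inl v => Sum.elim (fun k : ℕ => .W (-(k : ℤ))) (fun k : ℕ => .L (-(k : ℤ))) (ofLex v)
  | .inr none => .z
  | .inr (some (.inl k)) => .W ((k : ℤ) + 1)
  | .inr (some (.inr k)) => .L ((k : ℤ) + 1)

lemma toIndex_bijective : Function.Bijective toIndex := by
  constructor
  · have hW (k : ℕ) : toIndex (.inl (Sum.inl k : ℕ ⊕ ℕ)) = .W (-(k : ℤ)) := rfl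
    have hL (k : ℕ) : toIndex (.inl (Sum.inr k : ℕ ⊕ ℕ)) = .L (-(k : ℤ)) := rfl
    rintro ((v | v) | _ | k | k) ((v' | v') | _ | k' | k') h
    all_goals
      try simp only [hW, hL] at h
      try simp only [toIndex, W22Index.W.injEq, W22Index.L.injEq, reduceCtorEq] at h
    all_goals first
      | rfl
      | (exfalso; omega)
      | (have : v = v' := by omega
         subst this; rfl)
      | (have : k = k' := by omega
         subst this; rfl)
  · have key (n : ℤ) : (∃ k : ℕ, n = -(k : ℤ)) ∨ ∃ k : ℕ, n = (k : ℤ) + 1 := by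
      rcases le_or_gt n 0 with h | h
      · exact Or.inl ⟨(-n).toNat, by omega⟩
      · exact Or.inr ⟨(n - 1).toNat, by omega⟩
    rintro (n | n | _)
    · rcases key n with ⟨k, rfl⟩ | ⟨k, rfl⟩
      exacts [⟨.inl (Sum.inrₗ k), rfl⟩, ⟨.inr (some (.inr k)), rfl⟩]
    · rcases key n with ⟨k, rfl⟩ | ⟨k, rfl⟩
      exacts [⟨.inl (Sum.inlₗ k), rfl⟩, ⟨.inr (some (.inl k)), rfl⟩]
    · exact ⟨.inr none, rfl⟩

/-- The basis of `W(2,2)` adapted to its triangular decomposition. -/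
def triBasis : Module.Basis (Var ⊕ PosIndex) ℂ W22 :=
  basis.reindex (Equiv.ofBijective toIndex toIndex_bijective).symm

lemma triBasis_apply (i : Var ⊕ PosIndex) : triBasis i = basis (toIndex i) := by
  simp [triBasis]

lemma triBasis_W_neg (k : ℕ) : triBasis (.inl (Sum.inlₗ k)) = W (-(k : ℤ)) := triBasis_apply _

lemma triBasis_L_neg (k : ℕ) : triBasis (.inl (Sum.inrₗ k)) = L (-(k : ℤ)) := triBasis_apply _

lemma triBasis_z : triBasis (.inr none) = z := triBasis_apply _

lemma triBasis_W_pos (k : ℕ) : triBasis (.inr (some (.inl k))) = W ((k : ℤ) + 1) :=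
  triBasis_apply _

lemma triBasis_L_pos (k : ℕ) : triBasis (.inr (some (.inr k))) = L ((k : ℤ) + 1) :=
  triBasis_apply _

variable (φ : LieAlgebra.LieCharacter ℂ plus) (ξ : ℂ)

/-- The character of `W₊ ⊕ ℂ z` that extends `φ` and maps `z` to `ξ`, on basis elements. -/
def posChar : PosIndex → ℂ
  | none => ξ
  | some (.inl k) => φ (plusW ((k : ℤ) + 1) (by omega))
  | some (.inr k) => φ (plusL ((k : ℤ) + 1) (by omega))

/-- The underlying space of the polynomial model. -/
abbrev Poly : Type := MvPolynomial Var ℂ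

/-- The action of `W(2,2)` on the polynomial model. -/
def rep : W22 →ₗ[ℂ] Poly →ₗ[ℂ] Poly := act triBasis (posChar φ ξ)

lemma rep_z_one : rep φ ξ z 1 = C ξ := by
  rw [rep, ← triBasis_z, act_inr_one]
  rfl

lemma rep_L_one {n : ℤ} (hn : 0 < n) : rep φ ξ (L n) 1 = C (φ (plusL n hn)) := by
  obtain ⟨k, rfl⟩ : ∃ k : ℕ, n = (k : ℤ) + 1 := ⟨(n - 1).toNat, by omega⟩
  rw [rep, ← triBasis_L_pos, act_inr_one]
  rfl

lemma rep_W_one {n : ℤ} (hn : 0 < n) : rep φ ξ (W n) 1 = C (φ (plusW n hn)) := by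
  obtain ⟨k, rfl⟩ : ∃ k : ℕ, n = (k : ℤ) + 1 := ⟨(n - 1).toNat, by omega⟩
  rw [rep, ← triBasis_W_pos, act_inr_one]
  rfl

lemma rep_plus_one (x : plus) : rep φ ξ x 1 = C (φ x) := by
  obtain ⟨x, hx⟩ := x
  change x ∈ Submodule.span ℂ plusSet at hx
  induction hx using Submodule.span_induction with
  | mem x h =>
    obtain ⟨n, hn, rfl | rfl⟩ := h
    exacts [rep_L_one φ ξ hn, rep_W_one φ ξ hn]
  | zero =>
    have : (⟨0, Submodule.zero_mem _⟩ : plus) = 0 := rfl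
    simp [this]
  | add x y hx hy h1 h2 =>
    have : (⟨x + y, Submodule.add_mem _ hx hy⟩ : plus) = ⟨x, hx⟩ + ⟨y, hy⟩ := rfl
    rw [this, map_add, C_add, ← h1, ← h2]
    simp
  | smul c x hx h =>
    have : (⟨c • x, Submodule.smul_mem _ c hx⟩ : plus) = c • ⟨x, hx⟩ := rfl
    rw [this, map_smul, smul_eq_mul, C_mul, ← h]
    simp [C_mul']

/-- The compatibility required by `act_lie`: `z` is central, and a character of `W₊` vanishes on
brackets. -/
lemma rep_lie_pos_one (a c : PosIndex) :
    rep φ ξ ⁅triBasis (.inr a), triBasis (.inr c)⁆ 1 = 0 := by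
  have hp (k : ℕ ⊕ ℕ) : triBasis (.inr (some k)) ∈ plus := by
    rcases k with k | k
    · exact triBasis_W_pos k ▸ (plusW ((k : ℤ) + 1) (by omega)).2
    · exact triBasis_L_pos k ▸ (plusL ((k : ℤ) + 1) (by omega)).2
  rcases a with _ | a
  · rw [triBasis_z, z_lie, map_zero, LinearMap.zero_apply]
  rcases c with _ | c
  · rw [triBasis_z, lie_z, map_zero, LinearMap.zero_apply]
  have h := rep_plus_one φ ξ ⁅(⟨_, hp a⟩ : plus), ⟨_, hp c⟩⁆
  rw [LieAlgebra.lieCharacter_apply_lie, C_0] at h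
  exact h

lemma rep_lie (x y : W22) (p : Poly) :
    rep φ ξ ⁅x, y⁆ p = rep φ ξ x (rep φ ξ y p) - rep φ ξ y (rep φ ξ x p) :=
  act_lie triBasis (posChar φ ξ) (rep_lie_pos_one φ ξ) x y p

lemma rep_rep (x y : W22) (p : Poly) :
    rep φ ξ x (rep φ ξ y p) = rep φ ξ y (rep φ ξ x p) + rep φ ξ ⁅x, y⁆ p := by
  rw [rep_lie]; abel

lemma rep_W_neg_mono {k : ℕ} {A : Multiset Var} (h : ∀ a ∈ A, Sum.inlₗ k ≤ a) :
    rep φ ξ (W (-(k : ℤ))) (mono ℂ A) = mono ℂ (Sum.inlₗ k ::ₘ A) := by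
  rw [← triBasis_W_neg, mono_cons]
  exact act_inl_mono triBasis (posChar φ ξ) _ A h

lemma rep_L_neg_mono {k : ℕ} {A : Multiset Var} (h : ∀ a ∈ A, Sum.inrₗ k ≤ a) :
    rep φ ξ (L (-(k : ℤ))) (mono ℂ A) = mono ℂ (Sum.inrₗ k ::ₘ A) := by
  rw [← triBasis_L_neg, mono_cons]
  exact act_inl_mono triBasis (posChar φ ξ) _ A h

/-- Induction over sorted monomials. -/
lemma mono_induction {P : Multiset Var → Prop} (zero : P 0)
    (W_cons : ∀ k B, (∀ a ∈ B, Sum.inlₗ k ≤ a) → P B → P (Sum.inlₗ k ::ₘ B))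
    (L_cons : ∀ k B, (∀ a ∈ B, Sum.inrₗ k ≤ a) → P B → P (Sum.inrₗ k ::ₘ B)) (A) : P A := by
  induction A using multiset_min_induction with
  | zero => exact zero
  | cons j B hj ih =>
    rcases j with k | k
    exacts [W_cons k B hj ih, L_cons k B hj ih]

lemma linearMap_ext_mono {N : Type*} [AddCommGroup N] [Module ℂ N] {f f' : Poly →ₗ[ℂ] N}
    (h : ∀ A, f (mono ℂ A) = f' (mono ℂ A)) : f = f' :=
  (monoBasis ℂ Var).ext fun A => by rw [monoBasis_apply, h]

lemma rep_z (p : Poly) : rep φ ξ z p = ξ • p := by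
  have h : rep φ ξ z = ξ • LinearMap.id := linearMap_ext_mono fun A => by
    induction A using mono_induction with
    | zero => simp [rep_z_one, C_eq_smul_one]
    | W_cons k B hB ih =>
      rw [← rep_W_neg_mono φ ξ hB, rep_rep, z_lie, ih]
      simp
    | L_cons k B hB ih =>
      rw [← rep_L_neg_mono φ ξ hB, rep_rep, z_lie, ih]
      simp
  rw [h]
  rfl

/-- The scalar by which `central n m` acts. -/
def centralScalar (n m : ℤ) : ℂ := if m + n = 0 then (((n : ℂ) ^ 3 - n) / 12) * ξ else 0

lemma rep_central (n m : ℤ) (p : Poly) : rep φ ξ (central n m) p = centralScalar ξ n m • p := by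
  unfold central centralScalar
  split_ifs <;> simp [rep_z, mul_smul]

lemma rep_W_W (n m : ℤ) (p : Poly) :
    rep φ ξ (W n) (rep φ ξ (W m) p) = rep φ ξ (W m) (rep φ ξ (W n) p) := by
  rw [rep_rep, lie_W_W]; simp

lemma rep_W_L (n m : ℤ) (p : Poly) :
    rep φ ξ (W n) (rep φ ξ (L m) p) = rep φ ξ (L m) (rep φ ξ (W n) p) -
      (((n : ℂ) - m) • rep φ ξ (W (n + m)) p + centralScalar ξ m n • p) := by
  rw [rep_rep, lie_W_L, ← rep_central φ]; simp [sub_eq_add_neg]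

lemma rep_L_W (n m : ℤ) (p : Poly) :
    rep φ ξ (L n) (rep φ ξ (W m) p) = rep φ ξ (W m) (rep φ ξ (L n) p) +
      (((m : ℂ) - n) • rep φ ξ (W (m + n)) p + centralScalar ξ n m • p) := by
  rw [rep_rep, lie_L_W, ← rep_central φ]; simp

lemma rep_L_L (n m : ℤ) (p : Poly) :
    rep φ ξ (L n) (rep φ ξ (L m) p) = rep φ ξ (L m) (rep φ ξ (L n) p) +
      (((m : ℂ) - n) • rep φ ξ (L (m + n)) p + centralScalar ξ n m • p) := by
  rw [rep_rep, lie_L_L, ← rep_central φ]; simp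

lemma inl_le_inr (k l : ℕ) : (Sum.inlₗ k : Var) ≤ Sum.inrₗ l := (Sum.Lex.inl_lt_inr k l).le

/-- The order of `Var` puts every `W` before every `L`, and the `W`'s commute; hence `W (-k)` can be
moved into its sorted place without corrections. -/
lemma rep_W_neg (k : ℕ) (p : Poly) :
    rep φ ξ (W (-(k : ℤ))) p = X (Sum.inlₗ k) * p := by
  have h : rep φ ξ (W (-(k : ℤ))) = LinearMap.mulLeft ℂ (X (Sum.inlₗ k)) :=
    linearMap_ext_mono fun A => by
      rw [LinearMap.mulLeft_apply, ← mono_cons]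
      induction A using mono_induction with
      | zero => exact rep_W_neg_mono φ ξ (by simp)
      | L_cons l B hB ih =>
        refine rep_W_neg_mono φ ξ fun a ha => ?_
        rcases Multiset.mem_cons.1 ha with rfl | ha
        exacts [inl_le_inr _ _, (inl_le_inr _ _).trans (hB a ha)]
      | W_cons l B hB ih =>
        rcases le_or_gt k l with hkl | hkl
        · refine rep_W_neg_mono φ ξ fun a ha => ?_
          have hkl : (Sum.inlₗ k : Var) ≤ Sum.inlₗ l := Sum.Lex.inl_le_inl_iff.2 hkl
          rcases Multiset.mem_cons.1 ha with rfl | ha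
          exacts [hkl, hkl.trans (hB a ha)]
        · rw [← rep_W_neg_mono φ ξ hB, rep_W_W, ih, rep_W_neg_mono φ ξ, Multiset.cons_swap]
          intro a ha
          rcases Multiset.mem_cons.1 ha with rfl | ha
          exacts [Sum.Lex.inl_le_inl_iff.2 hkl.le, hB a ha]
  rw [h, LinearMap.mulLeft_apply]

/-! ### The filtration by the number of factors `L (-k)` -/

/-- The weight of a variable: the number of factors `L (-k)`. -/
def wt : Var → ℕ := fun v => Sum.elim (fun _ => 0) (fun _ => 1) (ofLex v)

@[simp] lemma wt_inl (k : ℕ) : wt (Sum.inlₗ k) = 0 := rfl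

@[simp] lemma wt_inr (k : ℕ) : wt (Sum.inrₗ k) = 1 := rfl

/-- The number of factors `L (-k)` in a monomial. -/
def numL (A : Multiset Var) : ℕ := (A.map wt).sum

@[simp] lemma numL_zero : numL 0 = 0 := rfl

@[simp] lemma numL_cons (v : Var) (A : Multiset Var) : numL (v ::ₘ A) = wt v + numL A := by
  simp [numL]

/-- The span of the monomials with fewer than `d` factors `L (-k)`. -/
def filt (d : ℕ) : Submodule ℂ Poly := Submodule.span ℂ {p | ∃ A, numL A < d ∧ p = mono ℂ A}

lemma mono_mem_filt {A : Multiset Var} {d : ℕ} (h : numL A < d) : mono ℂ A ∈ filt d :=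
  Submodule.subset_span ⟨A, h, rfl⟩

lemma filt_mono {d e : ℕ} (h : d ≤ e) : filt d ≤ filt e :=
  Submodule.span_mono fun _ ⟨A, hA, hp⟩ => ⟨A, hA.trans_le h, hp⟩

lemma filt_zero : filt 0 = ⊥ := by simp [filt]

lemma map_mem_of_filt {N : Type*} [AddCommGroup N] [Module ℂ N] {d : ℕ}
    (f : Poly →ₗ[ℂ] N) (S : Submodule ℂ N) (h : ∀ A, numL A < d → f (mono ℂ A) ∈ S) {p : Poly}
    (hp : p ∈ filt d) : f p ∈ S := by
  have : filt d ≤ S.comap f := Submodule.span_le.2 fun _ ⟨A, hA, hp⟩ => hp ▸ h A hA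
  exact this hp

lemma X_inl_mul_mem (k : ℕ) {d : ℕ} {p : Poly} (hp : p ∈ filt d) :
    X (Sum.inlₗ k) * p ∈ filt d :=
  map_mem_of_filt (LinearMap.mulLeft ℂ (X (Sum.inlₗ k))) _ (fun A hA => by
    rw [LinearMap.mulLeft_apply, ← mono_cons]
    exact mono_mem_filt (by simpa using hA)) hp

lemma X_inr_mul_mem (k : ℕ) {d : ℕ} {p : Poly} (hp : p ∈ filt (d - 1)) :
    X (Sum.inrₗ k) * p ∈ filt d :=
  map_mem_of_filt (LinearMap.mulLeft ℂ (X (Sum.inrₗ k))) _ (fun A hA => by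
    rw [LinearMap.mulLeft_apply, ← mono_cons]
    exact mono_mem_filt (by rw [numL_cons, wt_inr]; omega)) hp

lemma C_mul_mem (c : ℂ) {d : ℕ} {p : Poly} (hp : p ∈ filt d) : C c * p ∈ filt d := by
  rw [C_mul']
  exact Submodule.smul_mem _ _ hp

/-- The leading symbol of `W m`. -/
def symW (m : ℤ) : Poly :=
  if h : 0 < m then C (φ (plusW m h)) else X (Sum.inlₗ (-m).toNat)

/-- The leading symbol of `L m`. -/
def symL (m : ℤ) : Poly := if 0 < m then 0 else X (Sum.inrₗ (-m).toNat)

lemma symW_pos {m : ℤ} (h : 0 < m) : symW φ m = C (φ (plusW m h)) := dif_pos h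

lemma symL_neg (k : ℕ) : symL (-(k : ℤ)) = X (Sum.inrₗ k) := by
  simp [symL]

lemma symW_mul_mem (m : ℤ) {d : ℕ} {p : Poly} (hp : p ∈ filt d) : symW φ m * p ∈ filt d := by
  unfold symW
  split_ifs
  exacts [C_mul_mem _ hp, X_inl_mul_mem _ hp]

lemma rep_W_nonpos {m : ℤ} (h : ¬ 0 < m) (p : Poly) : rep φ ξ (W m) p = symW φ m * p := by
  obtain ⟨k, rfl⟩ : ∃ k : ℕ, m = -(k : ℤ) := ⟨(-m).toNat, by omega⟩
  rw [rep_W_neg, symW, dif_neg h]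
  simp

lemma symL_mul_mem (m : ℤ) {d : ℕ} {p : Poly} (hp : p ∈ filt (d - 1)) :
    symL m * p ∈ filt d := by
  unfold symL
  split_ifs
  · simp
  · exact X_inr_mul_mem _ hp

/-- Commuting `W m` past `L (-k)` trades an `L` for a `W` or a scalar, which loses one factor;
commuting `L m` past `L (-k)` merges two `L`'s into at most one. The claims are proved together
since each commutator formula feeds into the other, with the `W` claim first at every level. -/
lemma rep_sub_sym_mem (d : ℕ) :
    (∀ (m : ℤ) (p : Poly), p ∈ filt d → rep φ ξ (W m) p - symW φ m * p ∈ filt (d - 1)) ∧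
    ∀ (m : ℤ) (p : Poly), p ∈ filt d → rep φ ξ (L m) p - symL m * p ∈ filt d := by
  induction d with
  | zero =>
    constructor <;>
    · intro m p hp
      rw [filt_zero, Submodule.mem_bot] at hp
      simp [hp]
  | succ d ih =>
    obtain ⟨ihW, ihL⟩ := ih
    have hW' (m : ℤ) {p : Poly} (hp : p ∈ filt d) : rep φ ξ (W m) p ∈ filt d := by
      have := add_mem (filt_mono (Nat.sub_le _ _) (ihW m p hp)) (symW_mul_mem φ m hp)
      rwa [sub_add_cancel] at this
    have hL' (m : ℤ) {e : ℕ} (he : e ≤ d + 1) {p : Poly} (hp : p ∈ filt d)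
        (hp' : p ∈ filt (e - 1)) (hde : d ≤ e) : rep φ ξ (L m) p ∈ filt e := by
      have := add_mem (filt_mono hde (ihL m p hp)) (symL_mul_mem m hp')
      rwa [sub_add_cancel] at this
    have hW (m : ℤ) (p : Poly) (hp : p ∈ filt (d + 1)) :
        rep φ ξ (W m) p - symW φ m * p ∈ filt d := by
      by_cases hm : 0 < m
      swap
      · simp [rep_W_nonpos φ ξ hm]
      rw [symW_pos φ hm]
      refine map_mem_of_filt (rep φ ξ (W m) - LinearMap.mulLeft ℂ (C (φ (plusW m hm)))) _
        (fun A => ?_) hp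
      rw [LinearMap.sub_apply, LinearMap.mulLeft_apply]
      induction A using mono_induction with
      | zero => simp [rep_W_one φ ξ hm]
      | W_cons k B hB ih =>
        intro hA
        rw [← rep_W_neg_mono φ ξ hB, rep_W_W, rep_W_neg, rep_W_neg, mul_left_comm, ← mul_sub]
        exact X_inl_mul_mem _ (ih (by simpa using hA))
      | L_cons k B hB _ =>
        intro hA
        have hd : numL B < d := by rw [numL_cons, wt_inr] at hA; omega
        have hBd : mono ℂ B ∈ filt d := mono_mem_filt hd
        have h1 := ihW m _ hBd
        rw [symW_pos φ hm, C_mul'] at h1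
        rw [← rep_L_neg_mono φ ξ hB, rep_W_L, C_mul', sub_right_comm, ← map_smul, ← map_sub]
        exact sub_mem (hL' _ (Nat.le_succ d) (filt_mono (Nat.sub_le _ _) h1) h1 le_rfl)
          (add_mem (Submodule.smul_mem _ _ (hW' _ hBd)) (Submodule.smul_mem _ _ hBd))
    have hW'' (m : ℤ) {p : Poly} (hp : p ∈ filt (d + 1)) : rep φ ξ (W m) p ∈ filt (d + 1) := by
      have := add_mem (filt_mono (Nat.le_succ d) (hW m p hp)) (symW_mul_mem φ m hp)
      rwa [sub_add_cancel] at this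
    refine ⟨hW, fun m p hp => ?_⟩
    refine map_mem_of_filt (rep φ ξ (L m) - LinearMap.mulLeft ℂ (symL m)) _ (fun A => ?_) hp
    rw [LinearMap.sub_apply, LinearMap.mulLeft_apply]
    have sorted (k : ℕ) (A : Multiset Var) (h : ∀ a ∈ A, Sum.inrₗ k ≤ a) :
        rep φ ξ (L (-(k : ℤ))) (mono ℂ A) - symL (-(k : ℤ)) * mono ℂ A ∈ filt (d + 1) := by
      rw [rep_L_neg_mono φ ξ h, symL_neg, mono_cons, sub_self]
      exact zero_mem _
    induction A using mono_induction with
    | zero =>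
      intro _
      by_cases hm : 0 < m
      · rw [mono_zero, rep_L_one φ ξ hm, symL, if_pos hm, zero_mul, sub_zero, C_eq_smul_one,
          ← mono_zero]
        exact Submodule.smul_mem _ _ (mono_mem_filt (by simp))
      · obtain ⟨k, rfl⟩ : ∃ k : ℕ, m = -(k : ℤ) := ⟨(-m).toNat, by omega⟩
        exact sorted k 0 (by simp)
    | W_cons k B hB ih =>
      intro hA
      have hBd : numL B < d + 1 := by simpa using hA
      have hB' : mono ℂ B ∈ filt (d + 1) := mono_mem_filt hBd
      rw [← rep_W_neg_mono φ ξ hB, rep_L_W, rep_W_neg, rep_W_neg, mul_left_comm, add_sub_right_comm,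
        ← mul_sub]
      exact add_mem (X_inl_mul_mem _ (ih hBd))
        (add_mem (Submodule.smul_mem _ _ (hW'' _ hB')) (Submodule.smul_mem _ _ hB'))
    | L_cons k B hB _ =>
      intro hA
      have hd : numL B < d := by rw [numL_cons, wt_inr] at hA; omega
      have hBd : mono ℂ B ∈ filt d := mono_mem_filt hd
      have hBd' := filt_mono (Nat.le_succ d) hBd
      have rest : ((((-(k : ℤ)) : ℤ) : ℂ) - m) • rep φ ξ (L (-(k : ℤ) + m)) (mono ℂ B) +
          centralScalar ξ m (-(k : ℤ)) • mono ℂ B ∈ filt (d + 1) :=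
        add_mem (Submodule.smul_mem _ _ (hL' _ le_rfl hBd hBd (Nat.le_succ d)))
          (Submodule.smul_mem _ _ hBd')
      have h1 := ihL m _ hBd
      have h2 := hL' (-(k : ℤ)) le_rfl h1 h1 (Nat.le_succ d)
      by_cases hm : 0 < m
      · rw [← rep_L_neg_mono φ ξ hB, rep_L_L]
        simp only [symL, if_pos hm, zero_mul, sub_zero] at h2 ⊢
        exact add_mem h2 rest
      · obtain ⟨l, rfl⟩ : ∃ l : ℕ, m = -(l : ℤ) := ⟨(-m).toNat, by omega⟩
        rcases le_or_gt l k with hl | hl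
        · refine sorted l _ fun a ha => ?_
          have hl : (Sum.inrₗ l : Var) ≤ Sum.inrₗ k := Sum.Lex.inr_le_inr_iff.2 hl
          rcases Multiset.mem_cons.1 ha with rfl | ha
          exacts [hl, hl.trans (hB a ha)]
        -- Now `L (-l)` is out of order. After the exchange, `L (-k)` comes in front of letters that
        -- are all at least its own, so its action on the symbol part is exact.
        · have hs : rep φ ξ (L (-(k : ℤ))) (symL (-(l : ℤ)) * mono ℂ B) =
              symL (-(l : ℤ)) * mono ℂ (Sum.inrₗ k ::ₘ B) := by
            rw [symL_neg, ← mono_cons, ← mono_cons, rep_L_neg_mono, Multiset.cons_swap]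
            intro a ha
            rcases Multiset.mem_cons.1 ha with rfl | ha
            exacts [Sum.Lex.inr_le_inr_iff.2 hl.le, hB a ha]
          rw [map_sub, hs] at h2
          nth_rewrite 1 [← rep_L_neg_mono φ ξ hB]
          rw [rep_L_L, add_sub_right_comm]
          exact add_mem h2 rest

lemma rep_W_sub_mem (m : ℤ) {d : ℕ} {p : Poly} (hp : p ∈ filt d) :
    rep φ ξ (W m) p - symW φ m * p ∈ filt (d - 1) := (rep_sub_sym_mem φ ξ d).1 m p hp

lemma rep_L_sub_mem (m : ℤ) {d : ℕ} {p : Poly} (hp : p ∈ filt d) :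
    rep φ ξ (L m) p - symL m * p ∈ filt d := (rep_sub_sym_mem φ ξ d).2 m p hp

/-- The derivation by which `W n - φ (W n)` acts on leading terms. -/
def derW (n : ℤ) : Derivation ℂ Poly Poly :=
  mkDerivation ℂ fun v => Sum.elim (fun _ => 0) (fun k : ℕ =>
    -(((n : ℂ) - (-(k : ℤ) : ℤ)) • symW φ (n + -(k : ℤ)) + C (centralScalar ξ (-(k : ℤ)) n)))
    (ofLex v)

lemma derW_inl (n : ℤ) (k : ℕ) : derW φ ξ n (X (Sum.inlₗ k)) = 0 := mkDerivation_X _ _ _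

lemma derW_inr (n : ℤ) (k : ℕ) : derW φ ξ n (X (Sum.inrₗ k)) =
    -(((n : ℂ) - (-(k : ℤ) : ℤ)) • symW φ (n + -(k : ℤ)) + C (centralScalar ξ (-(k : ℤ)) n)) :=
  mkDerivation_X _ _ _

lemma derW_inr_mul_mem (n : ℤ) (k : ℕ) {d : ℕ} {p : Poly} (hp : p ∈ filt d) :
    derW φ ξ n (X (Sum.inrₗ k)) * p ∈ filt d := by
  rw [derW_inr, neg_mul, add_mul, smul_mul_assoc]
  exact neg_mem (add_mem (Submodule.smul_mem _ _ (symW_mul_mem φ _ hp)) (C_mul_mem _ hp))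

lemma derW_mem (n : ℤ) {d : ℕ} {p : Poly} (hp : p ∈ filt d) : derW φ ξ n p ∈ filt (d - 1) := by
  refine map_mem_of_filt (derW φ ξ n).toLinearMap _ (fun A => ?_) hp
  clear hp
  change _ → derW φ ξ n (mono ℂ A) ∈ _
  induction A using mono_induction generalizing d with
  | zero => simp
  | W_cons k B hB ih =>
    intro hA
    rw [mono_cons, Derivation.leibniz, derW_inl, smul_zero, add_zero, smul_eq_mul]
    exact X_inl_mul_mem _ (ih (by simpa using hA))
  | L_cons k B hB ih =>
    intro hA
    obtain ⟨e, rfl⟩ : ∃ e, d = e + 1 := ⟨d - 1, by omega⟩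
    have hB : numL B < e := by rw [numL_cons, wt_inr] at hA; omega
    rw [mono_cons, Derivation.leibniz, smul_eq_mul, smul_eq_mul, mul_comm (mono ℂ B)]
    exact add_mem (X_inr_mul_mem _ (ih hB))
      (derW_inr_mul_mem φ ξ n k (mono_mem_filt hB))

/-- One commutator with some `L (-k)` costs one factor `L` and gives the Leibniz sum; a second
commutator or a reordering of the result costs another. Truncated subtraction makes the formula
exact for `d ≤ 2`. -/
lemma rep_W_sub_derW_mem {n : ℤ} (hn : 0 < n) {d : ℕ} {p : Poly} (hp : p ∈ filt d) :
    rep φ ξ (W n) p - φ (plusW n hn) • p - derW φ ξ n p ∈ filt (d - 2) := by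
  refine map_mem_of_filt (rep φ ξ (W n) - φ (plusW n hn) • LinearMap.id -
    (derW φ ξ n).toLinearMap) _ (fun A => ?_) hp
  clear hp
  change _ → rep φ ξ (W n) (mono ℂ A) - φ (plusW n hn) • mono ℂ A - derW φ ξ n (mono ℂ A) ∈ _
  induction A using mono_induction generalizing d with
  | zero => simp [rep_W_one φ ξ hn, C_eq_smul_one]
  | W_cons k B hB ih =>
    intro hA
    rw [← rep_W_neg_mono φ ξ hB, rep_W_W, rep_W_neg, rep_W_neg, Derivation.leibniz, derW_inl,
      smul_zero, add_zero, smul_eq_mul, ← mul_smul_comm, ← mul_sub, ← mul_sub]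
    exact X_inl_mul_mem _ (ih (by simpa using hA))
  | L_cons k B hB ih =>
    intro hA
    obtain ⟨e, rfl⟩ : ∃ e, d = e + 1 := ⟨d - 1, by omega⟩
    have hBe : numL B < e := by rw [numL_cons, wt_inr] at hA; omega
    have hBe' : mono ℂ B ∈ filt e := mono_mem_filt hBe
    have h1 := ih hBe
    have h2 := rep_L_sub_mem φ ξ (-(k : ℤ)) h1
    have h3 := rep_L_sub_mem φ ξ (-(k : ℤ)) (derW_mem φ ξ n hBe')
    have h4 := rep_W_sub_mem φ ξ (n + -(k : ℤ)) hBe'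
    have h5 : symL (-(k : ℤ)) * (rep φ ξ (W n) (mono ℂ B) - φ (plusW n hn) • mono ℂ B -
        derW φ ξ n (mono ℂ B)) ∈ filt (e - 1) :=
      -- Multiplication by `L (-k)` raises the remainder from `filt (e - 2)` only to `filt (e - 1)`,
      -- even when the subtraction truncates, because `filt 0` is zero.
      symL_mul_mem _ (by rwa [Nat.sub_sub])
    have h6 := add_mem (add_mem (filt_mono (by omega) h2) h5) (sub_mem h3
      (Submodule.smul_mem _ ((n : ℂ) - (-(k : ℤ) : ℤ)) h4))
    have hL : rep φ ξ (L (-(k : ℤ))) (mono ℂ B) = X (Sum.inrₗ k) * mono ℂ B := by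
      rw [rep_L_neg_mono φ ξ hB, mono_cons]
    rw [show e + 1 - 2 = e - 1 by omega]
    convert h6 using 1
    rw [← rep_L_neg_mono φ ξ hB, rep_W_L, hL, Derivation.leibniz, derW_inr, symL_neg, map_sub,
      map_sub, map_smul, hL]
    simp only [smul_eq_mul, smul_eq_C_mul]
    ring

end

end W22

/-! ### Simplicity of the polynomial model -/

namespace W22

open MvPolynomial InducedPoly

noncomputable section

lemma pderiv_ne_zero_of_mem_vars {σ K : Type*} [Field K] [CharZero K] {p : MvPolynomial σ K}
    {i : σ} (h : i ∈ p.vars) : pderiv i p ≠ 0 := by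
  classical
  obtain ⟨m, hm, hi⟩ := (mem_vars_iff_mem_support _).1 h
  intro h0
  have h1 := coeff_pderiv p (i := i) (m - Finsupp.single i 1)
  rw [h0, coeff_zero, tsub_add_cancel_of_le] at h1
  · refine mul_ne_zero (mem_support_iff.1 hm) ?_ h1.symm
    exact Nat.cast_add_one_ne_zero _
  · rw [Finsupp.single_le_iff]
    exact Nat.one_le_iff_ne_zero.2 (Finsupp.mem_support_iff.1 hi)

lemma totalDegree_pderiv_lt {σ K : Type*} [Field K] {p : MvPolynomial σ K}
    {i : σ} (h : i ∈ p.vars) : (pderiv i p).totalDegree < p.totalDegree := by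
  classical
  have key (m : σ →₀ ℕ) (hm : m ∈ (pderiv i p).support) :
      (m.sum fun _ e => e) < p.totalDegree := by
    rw [mem_support_iff, coeff_pderiv] at hm
    have h1 := le_totalDegree (mem_support_iff.2 (left_ne_zero_of_mul hm))
    rw [Finsupp.sum_add_index' (fun _ => rfl) (fun _ _ _ => rfl),
      Finsupp.sum_single_index rfl] at h1
    omega
  refine (Finset.sup_lt_iff ?_).2 key
  obtain ⟨m, hm, hi⟩ := (mem_vars_iff_mem_support _).1 h
  have h1 := le_totalDegree hm
  have h2 : m i ≤ m.sum fun _ e => e :=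
    Finset.single_le_sum (f := fun j => m j) (fun _ _ => Nat.zero_le _) hi
  have h3 := Finsupp.mem_support_iff.1 hi
  rw [bot_eq_zero]
  omega

variable (φ : LieAlgebra.LieCharacter ℂ plus) (ξ : ℂ)

lemma var_eq_inl_or_inr (v : Var) : (∃ k, v = Sum.inlₗ k) ∨ ∃ k, v = Sum.inrₗ k := by
  rcases v with k | k
  exacts [Or.inl ⟨k, rfl⟩, Or.inr ⟨k, rfl⟩]

lemma inl_ne_inr (k l : ℕ) : (Sum.inlₗ k : Var) ≠ Sum.inrₗ l := Sum.inl_ne_inr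

/-- The bracket of `L 1` and `W (n - 1)` is `(n - 2) W n`, and `n ≠ 2`. -/
lemma char_W_eq_zero {n : ℤ} (hn : 3 ≤ n) : φ (plusW n (by omega)) = 0 := by
  have h := LieAlgebra.lieCharacter_apply_lie φ (plusL 1 one_pos) (plusW (n - 1) (by omega))
  have e : ⁅plusL 1 one_pos, plusW (n - 1) (by omega)⁆ = ((n : ℂ) - 2) • plusW n (by omega) := by
    refine Subtype.ext ?_
    change ⁅L 1, W (n - 1)⁆ = ((n : ℂ) - 2) • W n
    rw [lie_L_W, central, if_neg (by omega), add_zero, sub_add_cancel]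
    push_cast
    congr 1
    ring
  rw [e, map_smul, smul_eq_mul] at h
  refine (mul_eq_zero.1 h).resolve_left fun h0 => ?_
  have h1 : (n : ℂ) = ((2 : ℤ) : ℂ) := by push_cast; linear_combination h0
  have := Int.cast_injective h1
  omega

lemma symW_eq_zero {n : ℤ} (hn : 3 ≤ n) : symW φ n = 0 := by
  rw [symW_pos φ (by omega), char_W_eq_zero φ hn, C_0]

lemma mono_mem_weightedHomogeneous (A : Multiset Var) :
    IsWeightedHomogeneous wt (mono ℂ A) (numL A) := by
  induction A using Multiset.induction_on with
  | empty => simpa using isWeightedHomogeneous_one ℂ wt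
  | cons i A ih =>
    rw [mono_cons, numL_cons]
    exact (isWeightedHomogeneous_X ℂ wt i).mul ih

lemma component_eq_zero_of_mem_filt {d : ℕ} {p : Poly} (hp : p ∈ filt d) :
    weightedHomogeneousComponent wt d p = 0 :=
  (Submodule.mem_bot ℂ).1 (map_mem_of_filt (weightedHomogeneousComponent wt d) ⊥
    (fun A hA => (mono_mem_weightedHomogeneous A).weightedHomogeneousComponent_ne d hA.ne') hp)

lemma sub_component_mem_filt {d : ℕ} {p : Poly} (hp : p ∈ filt (d + 1)) :
    p - weightedHomogeneousComponent wt d p ∈ filt d := by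
  refine map_mem_of_filt (LinearMap.id - weightedHomogeneousComponent wt d) _ (fun A hA => ?_) hp
  rw [LinearMap.sub_apply, LinearMap.id_apply]
  have h := mono_mem_weightedHomogeneous A
  rcases (Nat.lt_succ_iff.1 hA).eq_or_lt with rfl | hA
  · rw [h.weightedHomogeneousComponent_same, sub_self]
    exact zero_mem _
  · rw [h.weightedHomogeneousComponent_ne d hA.ne', sub_zero]
    exact mono_mem_filt hA

lemma exists_mem_filt (p : Poly) : ∃ d, p ∈ filt d := by
  rw [← (monoBasis ℂ Var).linearCombination_repr p, Finsupp.linearCombination_apply, Finsupp.sum]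
  refine ⟨((monoBasis ℂ Var).repr p).support.sup numL + 1, Submodule.sum_mem _ fun A hA => ?_⟩
  rw [monoBasis_apply]
  exact Submodule.smul_mem _ _ (mono_mem_filt (Nat.lt_succ_of_le (Finset.le_sup hA)))

/-- The largest index of a variable of a given kind. -/
lemma exists_max_index {p : Poly} (f : ℕ → Var) (hf : Function.Injective f)
    (h : ∃ k, f k ∈ p.vars) : ∃ K, f K ∈ p.vars ∧ ∀ k, f k ∈ p.vars → k ≤ K := by
  obtain ⟨k, hk⟩ := h
  have hfin : (p.vars.preimage f hf.injOn).Nonempty := ⟨k, by simpa using hk⟩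
  exact ⟨_, by simpa using Finset.max'_mem _ hfin, fun k hk =>
    Finset.le_max' _ k (Finset.mem_preimage.2 hk)⟩

/-- The value of `derW φ ξ (K + 2)` on the variables `L (-k)` with `k ≤ K`. -/
lemma derW_top {K k : ℕ} (hk : k ≤ K) : derW φ ξ ((K : ℤ) + 2) (X (Sum.inrₗ k)) =
    if k = K then C (-((2 * K + 2) * φ (plusW 2 two_pos))) else 0 := by
  rw [derW_inr, centralScalar, if_neg (by omega), C_0, add_zero]
  split_ifs with h
  · subst h
    rw [show (k : ℤ) + 2 + -(k : ℤ) = 2 by ring, symW_pos φ two_pos, smul_eq_C_mul, ← C_mul,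
      ← C_neg]
    push_cast
    congr 1
    ring
  · rw [symW_eq_zero φ (by omega), smul_zero, neg_zero]

variable {φ} (h2 : φ (plusW 2 two_pos) ≠ 0)

include h2

lemma two_mul_add_two_mul_ne_zero (K : ℕ) : (2 * (K : ℂ) + 2) * φ (plusW 2 two_pos) ≠ 0 :=
  mul_ne_zero (by exact_mod_cast Nat.succ_ne_zero (2 * K + 1)) h2

variable {S : Submodule ℂ Poly} (hS : ∀ x, ∀ p ∈ S, rep φ ξ x p ∈ S)

include hS

/-- Subtracting `φ (W n)` from `W n` always removes a filtration step; the choice `n = K + 2`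
ensures that the result is not zero, since its part of weight `d` is a nonzero multiple of a partial
derivative of the leading part `t`. -/
lemma exists_lower_filt {d : ℕ} {p : Poly} (hp : p ∈ S) (hp0 : p ≠ 0) (hd : p ∈ filt (d + 2)) :
    ∃ q ∈ S, q ≠ 0 ∧ q ∈ filt (d + 1) := by
  obtain ⟨t, ht⟩ : ∃ t, weightedHomogeneousComponent wt (d + 1) p = t := ⟨_, rfl⟩
  have hth : IsWeightedHomogeneous wt t (d + 1) :=
    ht ▸ weightedHomogeneousComponent_isWeightedHomogeneous (d + 1) p
  have hl := sub_component_mem_filt hd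
  rw [ht] at hl
  by_cases ht0 : t = 0
  · exact ⟨p, hp, hp0, by simpa [ht0] using hl⟩
  -- A monomial without any `L (-k)` has weight `0`, whereas `t` has weight `d + 1`.
  have hex : ∃ k, Sum.inrₗ k ∈ t.vars := by
    obtain ⟨m, hm⟩ := ne_zero_iff.1 ht0
    have hw := hth hm
    by_contra hno
    push Not at hno
    have : Finsupp.weight wt m = 0 := by
      rw [Finsupp.weight_apply]
      refine Finset.sum_eq_zero fun v hv => ?_
      rcases var_eq_inl_or_inr v with ⟨k, rfl⟩ | ⟨k, rfl⟩
      · exact mul_zero _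
      · exact absurd ((mem_vars_iff_mem_support _).2 ⟨m, mem_support_iff.2 hm, hv⟩) (hno k)
    omega
  obtain ⟨K, hK, hmax⟩ := exists_max_index Sum.inrₗ (fun _ _ h => Sum.inr.inj h) hex
  have hpos : 0 < (K : ℤ) + 2 := by omega
  refine ⟨rep φ ξ (W ((K : ℤ) + 2)) p - φ (plusW _ hpos) • p,
    sub_mem (hS _ _ hp) (Submodule.smul_mem _ _ hp), fun h0 => ?_, ?_⟩
  · have h1 := rep_W_sub_derW_mem φ ξ hpos hd
    rw [h0, zero_sub, neg_mem_iff] at h1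
    have h3 := sub_mem h1 (derW_mem φ ξ ((K : ℤ) + 2) hl)
    rw [map_sub, sub_sub_cancel, Nat.add_sub_cancel] at h3
    set c := -((2 * (K : ℂ) + 2) * φ (plusW 2 two_pos)) with hc
    have hc0 : c ≠ 0 := neg_ne_zero.2 (two_mul_add_two_mul_ne_zero h2 K)
    -- The two derivations need to agree only on the variables of `t`, where `L`-indices are at most
    -- `K`; on larger ones `derW` need not vanish.
    have h4 : derW φ ξ ((K : ℤ) + 2) t = (c • pderiv (Sum.inrₗ K : Var)) t := by
      refine derivation_eq_of_forall_mem_vars fun v hv => ?_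
      rw [Derivation.smul_apply]
      rcases var_eq_inl_or_inr v with ⟨k, rfl⟩ | ⟨k, rfl⟩
      · rw [pderiv_X_of_ne (inl_ne_inr _ _), smul_zero]
        exact derW_inl φ ξ _ k
      · refine (derW_top φ ξ (hmax k hv)).trans ?_
        split_ifs with hkK
        · subst hkK
          rw [pderiv_X_self, ← hc, C_eq_smul_one]
        · rw [pderiv_X_of_ne (show (Sum.inrₗ k : Var) ≠ Sum.inrₗ K from
            fun h => hkK (Sum.inr.inj h)), smul_zero]
    rw [h4, Derivation.smul_apply] at h3
    have h5 := component_eq_zero_of_mem_filt ((Submodule.smul_mem_iff _ hc0).1 h3)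
    rw [(hth.pderiv (n' := d) (by simp)).weightedHomogeneousComponent_same] at h5
    exact pderiv_ne_zero_of_mem_vars hK h5
  · have h1 := rep_W_sub_mem φ ξ ((K : ℤ) + 2) hd
    rwa [symW_pos φ hpos, C_mul'] at h1

lemma exists_mem_filt_one (hS0 : S ≠ ⊥) : ∃ q ∈ S, q ≠ 0 ∧ q ∈ filt 1 := by
  obtain ⟨p, hp, hp0⟩ := (Submodule.ne_bot_iff S).1 hS0
  obtain ⟨d, hd⟩ := exists_mem_filt p
  induction d generalizing p with
  | zero =>
    rw [filt_zero] at hd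
    exact absurd hd hp0
  | succ d ih =>
    rcases d with _ | d
    · exact ⟨p, hp, hp0, hd⟩
    · obtain ⟨q, hq, hq0, hqd⟩ := exists_lower_filt ξ h2 hS hp hp0 hd
      exact ih q hq hq0 hqd

omit h2 hS

variable (φ)

/-- The derivation by which `L n - φ (L n)` acts on polynomials in the `W (-k)`. -/
def derL (n : ℤ) : Derivation ℂ Poly Poly :=
  mkDerivation ℂ fun v => Sum.elim (fun k : ℕ =>
    ((((-(k : ℤ)) : ℤ) : ℂ) - n) • symW φ (-(k : ℤ) + n) + C (centralScalar ξ n (-(k : ℤ))))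
    (fun _ => 0) (ofLex v)

lemma derL_inl (n : ℤ) (k : ℕ) : derL φ ξ n (X (Sum.inlₗ k)) =
    ((((-(k : ℤ)) : ℤ) : ℂ) - n) • symW φ (-(k : ℤ) + n) + C (centralScalar ξ n (-(k : ℤ))) :=
  mkDerivation_X _ _ _

lemma derL_inr (n : ℤ) (k : ℕ) : derL φ ξ n (X (Sum.inrₗ k)) = 0 := mkDerivation_X _ _ _

lemma derL_top {K k : ℕ} (hk : k ≤ K) : derL φ ξ ((K : ℤ) + 2) (X (Sum.inlₗ k)) =
    if k = K then C (-((2 * K + 2) * φ (plusW 2 two_pos))) else 0 := by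
  rw [derL_inl, centralScalar, if_neg (by omega), C_0, add_zero]
  split_ifs with h
  · subst h
    rw [show -(k : ℤ) + ((k : ℤ) + 2) = 2 by ring, symW_pos φ two_pos, smul_eq_C_mul, ← C_mul]
    push_cast
    congr 1
    ring
  · rw [symW_eq_zero φ (by omega), smul_zero]

/-- Without factors `L (-k)` nothing is left to reorder: each commutator of `L n` with a `W (-k)` is
a `W` or a central scalar and acts exactly by its symbol. -/
lemma rep_L_eq_derL {n : ℤ} (hn : 0 < n) {p : Poly} (hp : p ∈ filt 1) :
    rep φ ξ (L n) p = φ (plusL n hn) • p + derL φ ξ n p := by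
  have := map_mem_of_filt (rep φ ξ (L n) - φ (plusL n hn) • LinearMap.id -
    (derL φ ξ n).toLinearMap) ⊥ (fun A => ?_) hp
  · exact sub_eq_zero.1 ((sub_sub _ _ _).symm.trans ((Submodule.mem_bot ℂ).1 this))
  change _ → rep φ ξ (L n) (mono ℂ A) - φ (plusL n hn) • mono ℂ A - derL φ ξ n (mono ℂ A) = 0
  intro hA
  rw [sub_sub, sub_eq_zero]
  induction A using mono_induction with
  | zero => simp [rep_L_one φ ξ hn, C_eq_smul_one]
  | L_cons k B hB ih => simp at hA
  | W_cons k B hB ih =>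
    have hA' : numL B < 1 := by simpa using hA
    have h1 := rep_W_sub_mem φ ξ (-(k : ℤ) + n) (mono_mem_filt hA')
    rw [Nat.sub_self, filt_zero, Submodule.mem_bot, sub_eq_zero] at h1
    rw [← rep_W_neg_mono φ ξ hB, rep_L_W, rep_W_neg, rep_W_neg, ih hA', h1, Derivation.leibniz,
      derL_inl]
    simp only [smul_eq_mul, smul_eq_C_mul]
    ring

lemma vars_of_mem_filt_one {p : Poly} (hp : p ∈ filt 1) {v : Var} (hv : v ∈ p.vars) :
    ∃ k, v = Sum.inlₗ k := by
  have h : p ∈ Subalgebra.toSubmodule (supported ℂ (Set.range (Sum.inlₗ : ℕ → Var))) := by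
    refine map_mem_of_filt LinearMap.id _ (fun A hA => ?_) hp
    rw [LinearMap.id_apply, Subalgebra.mem_toSubmodule]
    induction A using mono_induction with
    | zero => exact mono_zero (K := ℂ) (ι := Var) ▸ one_mem _
    | L_cons k B hB ih => simp at hA
    | W_cons k B hB ih =>
      rw [mono_cons]
      exact mul_mem (X_mem_supported.2 ⟨k, rfl⟩) (ih (by simpa using hA))
  obtain ⟨k, hk⟩ := mem_supported.1 ((Subalgebra.mem_toSubmodule _).1 h) hv
  exact ⟨k, hk.symm⟩

variable {φ}

include h2 hS

/-- On polynomials in the `W (-k)`, the operator `L (K + 2) - φ (L (K + 2))` is a nonzero multiple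
of the derivative in the top variable, so the total degree falls until a nonzero constant is
reached. -/
lemma one_mem_of_mem_filt_one {p : Poly} (hp : p ∈ S) (hp0 : p ≠ 0) (h1 : p ∈ filt 1) :
    (1 : Poly) ∈ S := by
  induction hd : p.totalDegree using Nat.strong_induction_on generalizing p with
  | _ d ih =>
  rcases Finset.eq_empty_or_nonempty p.vars with hv | ⟨v, hv⟩
  · rw [vars_eq_empty_iff_eq_C] at hv
    rw [hv, C_eq_smul_one] at hp
    refine (Submodule.smul_mem_iff _ fun h0 => hp0 ?_).1 hp
    rw [hv, h0, C_0]
  · have hex : ∃ k, Sum.inlₗ k ∈ p.vars := by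
      obtain ⟨k, rfl⟩ := vars_of_mem_filt_one h1 hv
      exact ⟨k, hv⟩
    obtain ⟨K, hK, hmax⟩ := exists_max_index Sum.inlₗ (fun _ _ h => Sum.inl.inj h) hex
    have hpos : 0 < (K : ℤ) + 2 := by omega
    set c := -((2 * (K : ℂ) + 2) * φ (plusW 2 two_pos)) with hc
    have hc0 : c ≠ 0 := neg_ne_zero.2 (two_mul_add_two_mul_ne_zero h2 K)
    have h4 : derL φ ξ ((K : ℤ) + 2) p = (c • pderiv (Sum.inlₗ K : Var)) p := by
      refine derivation_eq_of_forall_mem_vars fun v hv => ?_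
      rw [Derivation.smul_apply]
      rcases var_eq_inl_or_inr v with ⟨k, rfl⟩ | ⟨k, rfl⟩
      · refine (derL_top φ ξ (hmax k hv)).trans ?_
        split_ifs with hkK
        · subst hkK
          rw [pderiv_X_self, ← hc, C_eq_smul_one]
        · rw [pderiv_X_of_ne (show (Sum.inlₗ k : Var) ≠ Sum.inlₗ K from
            fun h => hkK (Sum.inl.inj h)), smul_zero]
      · rw [pderiv_X_of_ne ((inl_ne_inr _ _).symm), smul_zero]
        exact derL_inr φ ξ _ k
    have h5 := rep_L_eq_derL φ ξ hpos h1
    rw [h4, Derivation.smul_apply] at h5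
    have h6 : c • pderiv (Sum.inlₗ K : Var) p =
        rep φ ξ (L ((K : ℤ) + 2)) p - φ (plusL _ hpos) • p := by rw [h5]; abel
    have h7 := rep_L_sub_mem φ ξ ((K : ℤ) + 2) h1
    rw [symL, if_pos hpos, zero_mul, sub_zero] at h7
    refine ih _ (hd ▸ totalDegree_pderiv_lt hK) ((Submodule.smul_mem_iff _ hc0).1 ?_)
      (pderiv_ne_zero_of_mem_vars hK) ((Submodule.smul_mem_iff _ hc0).1 ?_) rfl
    · rw [h6]
      exact sub_mem (hS _ _ hp) (Submodule.smul_mem _ _ hp)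
    · rw [h6]
      exact sub_mem h7 (Submodule.smul_mem _ _ h1)

omit h2 in
lemma eq_top_of_one_mem (h1 : (1 : Poly) ∈ S) : S = ⊤ := by
  rw [eq_top_iff, ← (monoBasis ℂ Var).span_eq, Submodule.span_le]
  rintro _ ⟨A, rfl⟩
  rw [monoBasis_apply, SetLike.mem_coe]
  induction A using mono_induction with
  | zero => exact mono_zero (K := ℂ) (ι := Var) ▸ h1
  | W_cons k B hB ih =>
    rw [← rep_W_neg_mono φ ξ hB]
    exact hS _ _ ih
  | L_cons k B hB ih =>
    rw [← rep_L_neg_mono φ ξ hB]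
    exact hS _ _ ih

/-- The polynomial model is simple. -/
theorem eq_top_of_rep_mem (hS0 : S ≠ ⊥) : S = ⊤ := by
  obtain ⟨q, hq, hq0, hq1⟩ := exists_mem_filt_one ξ h2 hS hS0
  exact eq_top_of_one_mem ξ hS (one_mem_of_mem_filt_one ξ h2 hS hq hq0 hq1)

end

end W22

/-! ### Linear independence of resolvents -/

section Dixmier

open Polynomial

/-- A product of injective translates of an endomorphism is injective. -/
lemma injective_aeval_prod_X_sub_C {K V : Type*} [Field K] [AddCommGroup V] [Module K V]
    (T : Module.End K V) (hT : ∀ c : K, Function.Injective (T - algebraMap K (Module.End K V) c))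
    (m : Multiset K) : Function.Injective (aeval T (m.map fun a => X - C a).prod) := by
  induction m using Multiset.induction_on with
  | empty =>
    rw [Multiset.map_zero, Multiset.prod_zero, map_one]
    exact Function.injective_id
  | cons a m ih =>
    rw [Multiset.map_cons, Multiset.prod_cons, map_mul, map_sub, aeval_X, aeval_C]
    exact (hT a).comp ih

/-- Over an algebraically closed field the polynomial splits, so its value at `T` is a nonzero
scalar times a product of translates. -/
lemma injective_aeval_of_ne_zero {K V : Type*} [Field K] [IsAlgClosed K] [AddCommGroup V]
    [Module K V] (T : Module.End K V) (hT : ∀ c : K, Function.Injective (T - algebraMap K (Module.End K V) c))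
    {P : K[X]} (hP : P ≠ 0) : Function.Injective (aeval T P) := by
  have h := (IsAlgClosed.splits P).eq_prod_roots
  rw [h, map_mul, aeval_C]
  exact (smul_right_injective V (leadingCoeff_ne_zero.2 hP)).comp
    (injective_aeval_prod_X_sub_C T hT P.roots)

/-- If no translate of an endomorphism has a kernel, then the inverse images of a nonzero vector
under its translates are linearly independent. -/
lemma linearIndependent_of_translates {K V : Type*} [Field K] [IsAlgClosed K] [AddCommGroup V]
    [Module K V] (T : Module.End K V) (hT : ∀ c : K, Function.Injective (T - algebraMap K (Module.End K V) c))
    {v : V} (hv : v ≠ 0) (w : K → V) (hw : ∀ c, (T - algebraMap K (Module.End K V) c) (w c) = v) :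
    LinearIndependent K w := by
  classical
  rw [linearIndependent_iff']
  intro s g hg i hi
  by_contra hgi
  -- Numerator of `∑ g j / (X - j)` over the common denominator. A linear relation among the `w j`
  -- gives `P(T) v = 0`, while at `i` only the `i`-th summand survives, so `P` is nonzero.
  let P : K[X] := ∑ j ∈ s, C (g j) * ∏ k ∈ s.erase j, (X - C k)
  have hP : P ≠ 0 := by
    intro h0
    have h1 := congrArg (eval i) h0
    rw [eval_finsetSum, Finset.sum_eq_single i] at h1
    · rw [eval_mul, eval_C, eval_prod, eval_zero] at h1
      refine mul_ne_zero hgi (Finset.prod_ne_zero_iff.2 fun k hk => ?_) h1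
      rw [eval_sub, eval_X, eval_C, sub_ne_zero]
      exact (Finset.ne_of_mem_erase hk).symm
    · intro j hj hji
      rw [eval_mul, eval_prod, Finset.prod_eq_zero (Finset.mem_erase.2 ⟨hji.symm, hi⟩) (by simp),
        mul_zero]
    · exact fun h => absurd hi h
  have key : aeval T P v = aeval T (∏ k ∈ s, (X - C k)) (∑ j ∈ s, g j • w j) := by
    rw [map_sum, map_sum, LinearMap.sum_apply]
    refine Finset.sum_congr rfl fun j hj => ?_
    rw [← Finset.mul_prod_erase s _ hj, mul_comm (X - C j), map_mul, map_mul, map_smul,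
      Module.End.mul_apply, Module.End.mul_apply, map_sub, aeval_X, aeval_C, aeval_C, hw,
      Module.algebraMap_end_apply]
  rw [hg, map_zero] at key
  exact hv (injective_aeval_of_ne_zero T hT hP (key.trans (map_zero _).symm))

end Dixmier

/-! ### The model as a Lie module and its universal property -/

namespace W22

open InducedPoly

noncomputable section

attribute [local instance 100] LieRing.ofAssociativeRing

variable (φ : LieAlgebra.LieCharacter ℂ plus) (ξ : ℂ)

/-- The polynomial model as a module over `W(2,2)`. -/
def Model (_φ : LieAlgebra.LieCharacter ℂ plus) (_ξ : ℂ) : Type := Poly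

instance : AddCommGroup (Model φ ξ) := inferInstanceAs (AddCommGroup Poly)

instance : Module ℂ (Model φ ξ) := inferInstanceAs (Module ℂ Poly)

instance : Nontrivial (Model φ ξ) := inferInstanceAs (Nontrivial Poly)

instance : LieRingModule W22 (Model φ ξ) where
  bracket x p := rep φ ξ x p
  add_lie x y p := congrArg (fun f : Poly →ₗ[ℂ] Poly => f p) (map_add (rep φ ξ) x y)
  lie_add x p q := map_add (rep φ ξ x) p q
  leibniz_lie x y p := (rep_rep φ ξ x y p).trans (add_comm _ _)

instance : LieModule ℂ W22 (Model φ ξ) where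
  smul_lie c x p := congrArg (fun f : Poly →ₗ[ℂ] Poly => f p) (map_smul (rep φ ξ) c x)
  lie_smul c x p := map_smul (rep φ ξ x) c p

/-- The generating Whittaker vector of the model. -/
def Model.one : Model φ ξ := (1 : Poly)

lemma Model.isWhittakerVector_one : IsWhittakerVector φ (Model.one φ ξ) := fun x =>
  (rep_plus_one φ ξ x).trans (MvPolynomial.C_eq_smul_one)

lemma Model.z_lie (p : Model φ ξ) : ⁅z, p⁆ = ξ • p := rep_z φ ξ p

lemma Model.isIrreducible (h2 : φ (plusW 2 two_pos) ≠ 0) :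
    LieModule.IsIrreducible ℂ W22 (Model φ ξ) := by
  refine LieModule.IsIrreducible.mk fun N hN => ?_
  rw [Ne, ← LieSubmodule.toSubmodule_eq_bot] at hN
  rw [← LieSubmodule.toSubmodule_eq_top]
  exact eq_top_of_rep_mem (S := N.toSubmodule) ξ h2 (fun x p hp => N.lie_mem hp) hN

section Universal

variable {V : Type*} [AddCommGroup V] [Module ℂ V] [LieRingModule W22 V] [LieModule ℂ W22 V]

variable {φ ξ}

omit [LieModule ℂ W22 V] in
lemma posChar_smul {v : V} (hv : IsWhittakerVector φ v) (hz : ⁅z, v⁆ = ξ • v) (a : PosIndex) :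
    ⁅triBasis (.inr a), v⁆ = posChar φ ξ a • v := by
  rcases a with _ | k | k
  · rw [triBasis_z, hz]
    rfl
  · rw [triBasis_W_pos]
    exact hv (plusW _ _)
  · rw [triBasis_L_pos]
    exact hv (plusL _ _)

/-- The universal property of the model. -/
def Model.lift {v : V} (hv : IsWhittakerVector φ v) (hz : ⁅z, v⁆ = ξ • v) :
    Model φ ξ →ₗ⁅ℂ, W22⁆ V :=
  { (toModule triBasis v : Poly →ₗ[ℂ] V) with
    map_lie' := fun {x p} => toModule_act triBasis (posChar φ ξ) v (posChar_smul hv hz) x p }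

lemma Model.lift_one {v : V} (hv : IsWhittakerVector φ v) (hz : ⁅z, v⁆ = ξ • v) :
    Model.lift hv hz (Model.one φ ξ) = v := toModule_one triBasis v

/-- A nontrivial Whittaker module with central character is isomorphic to the model. -/
lemma nonempty_model_equiv [Nontrivial V] (h2 : φ (plusW 2 two_pos) ≠ 0) {v : V}
    (hv : IsWhittakerVector φ v) (hz : ⁅z, v⁆ = ξ • v)
    (hgen : LieSubmodule.lieSpan ℂ W22 {v} = (⊤ : LieSubmodule ℂ W22 V)) :
    Nonempty (Model φ ξ ≃ₗ⁅ℂ, W22⁆ V) := by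
  have := Model.isIrreducible φ ξ h2
  let f := Model.lift hv hz
  have hf : f (Model.one φ ξ) = v := Model.lift_one hv hz
  have hsurj : Function.Surjective f := by
    rw [← LieModuleHom.range_eq_top, eq_top_iff, ← hgen, LieSubmodule.lieSpan_le]
    rintro _ rfl
    exact (LieModuleHom.mem_range f _).2 ⟨_, hf⟩
  have hinj : Function.Injective f := by
    rw [← LieModuleHom.ker_eq_bot]
    refine (IsSimpleOrder.eq_bot_or_eq_top f.ker).resolve_right fun htop => ?_
    obtain ⟨w, hw⟩ := exists_ne (0 : V)
    obtain ⟨p, rfl⟩ := hsurj w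
    have hp : p ∈ f.ker := htop ▸ LieSubmodule.mem_top p
    exact hw (LieModuleHom.mem_ker.1 hp)
  exact ⟨{ LinearEquiv.ofBijective (f : Model φ ξ →ₗ[ℂ] V) ⟨hinj, hsurj⟩ with
    map_lie' := fun {x p} => f.map_lie x p }⟩

end Universal

/-! ### Comparison of `M_φ` and `L_{φ,ξ}` with the model -/

section Enveloping

variable {R 𝔤 : Type*} [CommRing R] [LieRing 𝔤] [LieAlgebra R 𝔤]

/-- A universal enveloping algebra is generated by the Lie algebra. -/
lemma mem_of_ι_mem (s : Subalgebra R (UniversalEnvelopingAlgebra R 𝔤))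
    (h : ∀ x, UniversalEnvelopingAlgebra.ι R x ∈ s) (u : UniversalEnvelopingAlgebra R 𝔤) :
    u ∈ s := by
  let f : 𝔤 →ₗ⁅R⁆ s :=
    { toFun := fun x => ⟨UniversalEnvelopingAlgebra.ι R x, h x⟩
      map_add' := fun x y => Subtype.ext (map_add _ x y)
      map_smul' := fun c x => Subtype.ext (map_smul (UniversalEnvelopingAlgebra.ι R) c x)
      map_lie' := fun {x y} => Subtype.ext (LieHom.map_lie (UniversalEnvelopingAlgebra.ι R) x y) }
  have hf : s.val.comp (UniversalEnvelopingAlgebra.lift R f) = AlgHom.id R _ := by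
    apply UniversalEnvelopingAlgebra.hom_ext
    ext x
    change ((UniversalEnvelopingAlgebra.lift R f (UniversalEnvelopingAlgebra.ι R x) : s) :
      UniversalEnvelopingAlgebra R 𝔤) = UniversalEnvelopingAlgebra.ι R x
    rw [UniversalEnvelopingAlgebra.lift_ι_apply]
    rfl
  rw [← AlgHom.id_apply (R := R) u, ← hf]
  exact (UniversalEnvelopingAlgebra.lift R f u).2

end Enveloping

/-- The generator `1 ⊗ 1` of `M_φ`. -/
def M.one : M φ := Submodule.Quotient.mk ((1 : UniversalEnvelopingAlgebra ℂ W22) ⊗ₜ[ℂ]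
  (show OneDim φ from (1 : ℂ)))

lemma M.mk_tmul (u : UniversalEnvelopingAlgebra ℂ W22) (c : ℂ) :
    (Submodule.Quotient.mk (u ⊗ₜ[ℂ] (show OneDim φ from c)) : M φ) = (c • u) • M.one φ := by
  have h : u ⊗ₜ[ℂ] (show OneDim φ from c) = (c • u) • ((1 : UniversalEnvelopingAlgebra ℂ W22) ⊗ₜ[ℂ]
      (show OneDim φ from (1 : ℂ))) := by
    rw [TensorProduct.smul_tmul', smul_eq_mul, mul_one, TensorProduct.smul_tmul]
    congr 1
    exact (mul_one c).symm
  rw [h]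
  rfl

lemma M.isWhittakerVector_one : IsWhittakerVector φ (M.one φ) := by
  intro x
  have h : (UniversalEnvelopingAlgebra.ι ℂ (x : W22)) ⊗ₜ[ℂ] (show OneDim φ from (1 : ℂ)) -
      (1 : UniversalEnvelopingAlgebra ℂ W22) ⊗ₜ[ℂ] (show OneDim φ from φ x) ∈
      inducedRel envelopingMap (OneDim φ) := by
    refine Submodule.subset_span ⟨1, UniversalEnvelopingAlgebra.ι ℂ x, (1 : ℂ), ?_⟩
    congr 1
    · rw [one_mul, envelopingMap, UniversalEnvelopingAlgebra.lift_ι_apply]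
      rfl
    · congr 1
      rw [smul_oneDim_def, UniversalEnvelopingAlgebra.lift_ι_apply, mul_one]
  have h' := (Submodule.Quotient.eq _).2 h
  have e1 := M.mk_tmul φ (UniversalEnvelopingAlgebra.ι ℂ (x : W22)) 1
  have e2 := M.mk_tmul φ 1 (φ x)
  rw [one_smul] at e1
  rw [smul_assoc, one_smul] at e2
  exact e1.symm.trans (h'.trans e2)

lemma M.lieSpan_one : LieSubmodule.lieSpan ℂ W22 {M.one φ} = (⊤ : LieSubmodule ℂ W22 (M φ)) := by
  rw [eq_top_iff]
  intro m _
  set S := LieSubmodule.lieSpan ℂ W22 {M.one φ}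
  have h1 : M.one φ ∈ S := LieSubmodule.subset_lieSpan rfl
  have hU (u : UniversalEnvelopingAlgebra ℂ W22) : ∀ m ∈ S, u • m ∈ S := by
    let s : Subalgebra ℂ (UniversalEnvelopingAlgebra ℂ W22) :=
      { carrier := {u | ∀ m ∈ S, u • m ∈ S}
        mul_mem' := fun {a b} ha hb m hm => by
          rw [mul_smul]
          exact ha _ (hb _ hm)
        add_mem' := fun {a b} ha hb m hm => by
          rw [add_smul]
          exact add_mem (ha _ hm) (hb _ hm)
        algebraMap_mem' := fun c m hm => by
          rw [algebraMap_smul]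
          exact S.smul_mem c hm }
    exact mem_of_ι_mem s (fun x m hm => S.lie_mem hm) u
  obtain ⟨t, rfl⟩ := Submodule.Quotient.mk_surjective (inducedRel envelopingMap (OneDim φ)) m
  induction t using TensorProduct.induction_on with
  | zero => exact S.zero_mem
  | tmul u c =>
    have := hU ((show ℂ from c) • u) _ h1
    rw [← M.mk_tmul] at this
    exact this
  | add a b ha hb => exact S.add_mem (ha trivial) (hb trivial)

/-- The action of `U(W)` on the model. -/
def Model.envRep : UniversalEnvelopingAlgebra ℂ W22 →ₐ[ℂ] Module.End ℂ (Model φ ξ) :=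
  UniversalEnvelopingAlgebra.lift ℂ (LieModule.toEnd ℂ W22 (Model φ ξ))

lemma Model.envRep_ι (x : W22) (p : Model φ ξ) :
    Model.envRep φ ξ (UniversalEnvelopingAlgebra.ι ℂ x) p = ⁅x, p⁆ := by
  rw [Model.envRep, UniversalEnvelopingAlgebra.lift_ι_apply, LieModule.toEnd_apply_apply]

/-- This makes the balancing relations vanish under `Model.eval`. It holds on generators by the
Whittaker property, and elements satisfying it form a subalgebra. -/
lemma Model.envRep_envelopingMap (a : UniversalEnvelopingAlgebra ℂ plus) :
    Model.envRep φ ξ (envelopingMap a) (Model.one φ ξ) =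
      UniversalEnvelopingAlgebra.lift ℂ φ a • Model.one φ ξ := by
  let s : Subalgebra ℂ (UniversalEnvelopingAlgebra ℂ plus) :=
    { carrier := {a | Model.envRep φ ξ (envelopingMap a) (Model.one φ ξ) =
        UniversalEnvelopingAlgebra.lift ℂ φ a • Model.one φ ξ}
      mul_mem' := fun {a b} ha hb => by
        simp only [Set.mem_ofPred_eq] at ha hb ⊢
        rw [map_mul, map_mul, map_mul, Module.End.mul_apply, hb, map_smul, ha, smul_smul, mul_comm]
      add_mem' := fun {a b} ha hb => by
        simp only [Set.mem_ofPred_eq] at ha hb ⊢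
        rw [map_add, map_add, map_add, LinearMap.add_apply, ha, hb, add_smul]
      algebraMap_mem' := fun c => by
        simp only [Set.mem_ofPred_eq, AlgHom.commutes]
        rw [Module.algebraMap_end_apply]
        rfl }
  refine mem_of_ι_mem s (fun x => ?_) a
  change Model.envRep φ ξ (envelopingMap (UniversalEnvelopingAlgebra.ι ℂ x)) (Model.one φ ξ) =
    UniversalEnvelopingAlgebra.lift ℂ φ (UniversalEnvelopingAlgebra.ι ℂ x) • Model.one φ ξ
  rw [envelopingMap, UniversalEnvelopingAlgebra.lift_ι_apply,
    UniversalEnvelopingAlgebra.lift_ι_apply]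
  exact (Model.envRep_ι φ ξ _ _).trans (Model.isWhittakerVector_one φ ξ x)

/-- The evaluation of `U(W) ⊗ ℂ_φ` at the generator of the model. -/
def Model.eval : UniversalEnvelopingAlgebra ℂ W22 ⊗[ℂ] OneDim φ →ₗ[ℂ] Model φ ξ :=
  TensorProduct.lift (LinearMap.mk₂ ℂ
    (fun u c => (show ℂ from c) • Model.envRep φ ξ u (Model.one φ ξ))
    (fun u u' c => by rw [map_add, LinearMap.add_apply, smul_add])
    (fun a u c => by rw [map_smul, LinearMap.smul_apply, smul_comm])
    (fun u c c' => add_smul _ _ _)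
    (fun a u c => mul_smul _ _ _))

lemma Model.eval_tmul (u : UniversalEnvelopingAlgebra ℂ W22) (c : OneDim φ) :
    Model.eval φ ξ (u ⊗ₜ c) = (show ℂ from c) • Model.envRep φ ξ u (Model.one φ ξ) := rfl

lemma Model.eval_smul (u : UniversalEnvelopingAlgebra ℂ W22)
    (t : UniversalEnvelopingAlgebra ℂ W22 ⊗[ℂ] OneDim φ) :
    Model.eval φ ξ (u • t) = Model.envRep φ ξ u (Model.eval φ ξ t) := by
  induction t using TensorProduct.induction_on with
  | zero => rw [smul_zero, map_zero, map_zero]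
  | tmul u' c =>
    rw [TensorProduct.smul_tmul', Model.eval_tmul, Model.eval_tmul, smul_eq_mul, map_mul, map_smul,
      Module.End.mul_apply]
  | add a b ha hb => rw [smul_add, map_add, map_add, map_add, ha, hb]

lemma Model.eval_eq_zero {t : UniversalEnvelopingAlgebra ℂ W22 ⊗[ℂ] OneDim φ}
    (ht : t ∈ inducedRel envelopingMap (OneDim φ)) : Model.eval φ ξ t = 0 := by
  induction ht using Submodule.span_induction with
  | mem t h =>
    obtain ⟨b, a, n, rfl⟩ := h
    rw [map_sub, Model.eval_tmul, Model.eval_tmul, map_mul, Module.End.mul_apply,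
      Model.envRep_envelopingMap, map_smul, smul_smul, sub_eq_zero]
    congr 1
    exact mul_comm _ _
  | zero => exact map_zero _
  | add a b _ _ ha hb => rw [map_add, ha, hb, add_zero]
  | smul u t _ h => rw [Model.eval_smul, h, map_zero]

/-- The generator of `L_{φ,ξ}`. -/
def LMod.one : LMod φ ξ := LieSubmodule.Quotient.mk (M.one φ)

/-- Evaluation in the model kills both the balancing relations and the image of `z - ξ`, yet it
sends the generator to `1`. -/
lemma LMod.one_ne_zero : LMod.one φ ξ ≠ 0 := by
  intro h0
  obtain ⟨m, hm⟩ := (mem_zSub φ ξ).1 ((LieSubmodule.Quotient.mk_eq_zero _).1 h0)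
  obtain ⟨t, rfl⟩ := Submodule.Quotient.mk_surjective (inducedRel envelopingMap (OneDim φ)) m
  have h1 : UniversalEnvelopingAlgebra.ι ℂ z • t - ξ • t -
      (1 : UniversalEnvelopingAlgebra ℂ W22) ⊗ₜ[ℂ] (show OneDim φ from (1 : ℂ)) ∈
      inducedRel envelopingMap (OneDim φ) := (Submodule.Quotient.eq _).1 hm
  have h2 := Model.eval_eq_zero φ ξ h1
  rw [map_sub, map_sub, Model.eval_smul, map_smul, Model.envRep_ι, Model.z_lie, sub_self, zero_sub,
    neg_eq_zero, Model.eval_tmul, map_one, Module.End.one_apply] at h2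
  exact _root_.one_ne_zero (α := Poly) ((one_smul ℂ (1 : Poly)).symm.trans h2)

instance : Nontrivial (LMod φ ξ) := ⟨_, _, LMod.one_ne_zero φ ξ⟩

lemma LMod.isWhittakerVector_one : IsWhittakerVector φ (LMod.one φ ξ) := fun x =>
  congrArg (LieSubmodule.Quotient.mk' (zSub φ ξ)) (M.isWhittakerVector_one φ x)

lemma LMod.lieSpan_one :
    LieSubmodule.lieSpan ℂ W22 {LMod.one φ ξ} = (⊤ : LieSubmodule ℂ W22 (LMod φ ξ)) := by
  rw [eq_top_iff]
  intro m _
  obtain ⟨m, rfl⟩ := LieSubmodule.Quotient.surjective_mk' (zSub φ ξ) m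
  have h : LieSubmodule.lieSpan ℂ W22 {M.one φ} ≤
      (LieSubmodule.lieSpan ℂ W22 {LMod.one φ ξ}).comap (LieSubmodule.Quotient.mk' (zSub φ ξ)) := by
    rw [LieSubmodule.lieSpan_le]
    rintro _ rfl
    exact LieSubmodule.subset_lieSpan rfl
  rw [M.lieSpan_one] at h
  exact h (LieSubmodule.mem_top m)

lemma LMod.hasCentralCharacter : HasCentralCharacter ξ (LMod φ ξ) := by
  intro m
  obtain ⟨m, rfl⟩ := LieSubmodule.Quotient.surjective_mk' (zSub φ ξ) m
  have h : ⁅z, m⁆ - ξ • m ∈ zSub φ ξ := (mem_zSub φ ξ).2 ⟨m, rfl⟩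
  rw [← LieSubmodule.Quotient.mk_eq_zero, map_sub, map_smul,
    sub_eq_zero] at h
  exact h

variable {φ} in
lemma LMod.nonempty_model_equiv (h2 : φ (plusW 2 two_pos) ≠ 0) :
    Nonempty (Model φ ξ ≃ₗ⁅ℂ, W22⁆ LMod φ ξ) :=
  W22.nonempty_model_equiv h2 (LMod.isWhittakerVector_one φ ξ) (LMod.hasCentralCharacter φ ξ _)
    (LMod.lieSpan_one φ ξ)

variable {φ} in
lemma LMod.isIrreducible (h2 : φ (plusW 2 two_pos) ≠ 0) :
    LieModule.IsIrreducible ℂ W22 (LMod φ ξ) := by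
  obtain ⟨e⟩ := LMod.nonempty_model_equiv ξ h2
  have := Model.isIrreducible φ ξ h2
  exact (LieSubmodule.orderIsoMapComap e).symm.isSimpleOrder

/-! ### Schur's lemma for the central element -/

section CentralCharacter

variable {V : Type*} [AddCommGroup V] [Module ℂ V] [LieRingModule W22 V] [LieModule ℂ W22 V]

/-- The action of `z - c` as a module endomorphism. -/
def zSubHom (V : Type*) [AddCommGroup V] [Module ℂ V] [LieRingModule W22 V] [LieModule ℂ W22 V]
    (c : ℂ) : V →ₗ⁅ℂ, W22⁆ V :=
  { LieModule.toEnd ℂ W22 V z - algebraMap ℂ (Module.End ℂ V) c with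
    map_lie' := fun {x v} => by
      change ⁅z, ⁅x, v⁆⁆ - c • ⁅x, v⁆ = ⁅x, ⁅z, v⁆ - c • v⁆
      rw [lie_sub, lie_smul, leibniz_lie x z v, lie_z, zero_lie, zero_add] }

lemma zSubHom_apply (c : ℂ) (v : V) : zSubHom V c v = ⁅z, v⁆ - c • v := rfl

instance : Countable W22Index :=
  have : Countable Var := inferInstanceAs (Countable (ℕ ⊕ ℕ))
  toIndex_bijective.surjective.countable

/-- A module generated by one vector has countable dimension. -/
lemma rank_le_aleph0 {v : V}
    (hgen : LieSubmodule.lieSpan ℂ W22 {v} = (⊤ : LieSubmodule ℂ W22 V)) :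
    Module.rank ℂ V ≤ Cardinal.aleph0 := by
  -- Words in the basis elements applied to `v` span a submodule, and there are only countably many
  -- words.
  let F : List W22Index → V := fun l => l.foldr (fun i w => ⁅basis i, w⁆) v
  let T : LieSubmodule ℂ W22 V :=
    { Submodule.span ℂ (Set.range F) with
      lie_mem := by
        intro x m hm
        change m ∈ Submodule.span ℂ (Set.range F) at hm
        change ⁅x, m⁆ ∈ Submodule.span ℂ (Set.range F)
        induction x using basis_induction with
        | add a b ha hb =>
          rw [add_lie]
          exact add_mem ha hb
        | smul c i =>
          rw [smul_lie]
          refine Submodule.smul_mem _ c ?_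
          induction hm using Submodule.span_induction with
          | mem m h =>
            obtain ⟨l, rfl⟩ := h
            exact Submodule.subset_span ⟨i :: l, rfl⟩
          | zero => rw [lie_zero]; exact zero_mem _
          | add a b _ _ ha hb => rw [lie_add]; exact add_mem ha hb
          | smul c m _ h => rw [lie_smul]; exact Submodule.smul_mem _ c h }
  have hT : T = ⊤ := by
    rw [eq_top_iff, ← hgen, LieSubmodule.lieSpan_le]
    rintro _ rfl
    exact Submodule.subset_span ⟨[], rfl⟩
  have hspan : Submodule.span ℂ (Set.range F) = ⊤ := by
    rw [← LieSubmodule.toSubmodule_inj] at hT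
    exact hT
  rw [← rank_top, ← hspan]
  exact (rank_span_le _).trans (Set.countable_range F).le_aleph0

/-- The central element acts by a scalar on a simple module generated by one vector. -/
lemma exists_hasCentralCharacter [LieModule.IsIrreducible ℂ W22 V] {v : V}
    (hgen : LieSubmodule.lieSpan ℂ W22 {v} = (⊤ : LieSubmodule ℂ W22 V)) :
    ∃ c, HasCentralCharacter c V := by
  have := LieModule.nontrivial_of_isIrreducible ℂ W22 V
  by_contra hno
  have hinj (c : ℂ) : Function.Injective (zSubHom V c) := by
    rw [← LieModuleHom.ker_eq_bot]
    refine (IsSimpleOrder.eq_bot_or_eq_top _).resolve_right fun htop => hno ⟨c, fun w => ?_⟩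
    have hw : w ∈ (zSubHom V c).ker := htop ▸ LieSubmodule.mem_top w
    exact sub_eq_zero.1 ((zSubHom_apply c w).symm.trans (LieModuleHom.mem_ker.1 hw))
  have hsurj (c : ℂ) : Function.Surjective (zSubHom V c) := by
    rw [← LieModuleHom.range_eq_top]
    refine (IsSimpleOrder.eq_bot_or_eq_top _).resolve_left fun hbot => ?_
    obtain ⟨w, hw⟩ := exists_ne (0 : V)
    have h1 : zSubHom V c w ∈ (zSubHom V c).range := (LieModuleHom.mem_range _ _).2 ⟨w, rfl⟩
    rw [hbot, LieSubmodule.mem_bot] at h1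
    exact hw (hinj c (h1.trans (map_zero _).symm))
  obtain ⟨u, hu⟩ := exists_ne (0 : V)
  choose w hw using fun c => hsurj c u
  -- If `z` is not scalar, every `z - c` is bijective by simplicity, and the preimages of `u` form
  -- an independent family indexed by all of `ℂ`, against countable dimension.
  have hli := linearIndependent_of_translates (LieModule.toEnd ℂ W22 V z) hinj hu w hw
  have h1 := hli.cardinal_lift_le_rank
  have h2 := Cardinal.lift_le.2 (rank_le_aleph0 hgen)
  rw [Cardinal.lift_aleph0] at h2
  have h3 := h1.trans h2
  rw [Cardinal.lift_le_aleph0, Cardinal.mk_complex] at h3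
  exact absurd h3 (not_le.2 Cardinal.aleph0_lt_continuum)

end CentralCharacter

end

end W22

/-! ### The classification -/

theorem theorem4p2 (φ : LieAlgebra.LieCharacter ℂ W22.plus) (hφ : W22.IsNonsingular φ) :
    (∀ ξ : ℂ, LieModule.IsIrreducible ℂ W22 (W22.LMod φ ξ) ∧
      W22.IsWhittakerModule φ (W22.LMod φ ξ) ∧
      W22.HasCentralCharacter ξ (W22.LMod φ ξ)) ∧
    (∀ ξ ξ' : ℂ, Nonempty (W22.LMod φ ξ ≃ₗ⁅ℂ, W22⁆ W22.LMod φ ξ') ↔ ξ = ξ') ∧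
    (∀ (V : Type*) [AddCommGroup V] [Module ℂ V] [LieRingModule W22 V] [LieModule ℂ W22 V],
      W22.IsWhittakerModule φ V → LieModule.IsIrreducible ℂ W22 V →
      ∃ ξ : ℂ, W22.HasCentralCharacter ξ V ∧ Nonempty (V ≃ₗ⁅ℂ, W22⁆ W22.LMod φ ξ)) := by
  have h2 : φ (W22.plusW 2 two_pos) ≠ 0 := right_ne_zero_of_mul hφ.2
  refine ⟨fun ξ => ⟨W22.LMod.isIrreducible ξ h2, ⟨_, W22.LMod.isWhittakerVector_one φ ξ,
    W22.LMod.lieSpan_one φ ξ⟩, W22.LMod.hasCentralCharacter φ ξ⟩, fun ξ ξ' => ⟨?_, ?_⟩, ?_⟩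
  · rintro ⟨e⟩
    have h := W22.LMod.hasCentralCharacter φ ξ' (e (W22.LMod.one φ ξ))
    have h' : e ⁅W22.z, W22.LMod.one φ ξ⁆ = ⁅W22.z, e (W22.LMod.one φ ξ)⁆ :=
      LieModuleHom.map_lie e.toLieModuleHom _ _
    rw [← h', W22.LMod.hasCentralCharacter φ ξ] at h
    have h3 : e (ξ • W22.LMod.one φ ξ) = ξ • e (W22.LMod.one φ ξ) :=
      map_smul e.toLinearEquiv _ _
    rw [h3] at h
    -- Both `ξ` and `ξ'` are the scalar by which `z` acts on the image of the generator, which is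
    -- nonzero.
    refine smul_left_injective ℂ (fun h0 => W22.LMod.one_ne_zero φ ξ (e.injective ?_)) h
    exact h0.trans (map_zero e.toLinearEquiv).symm
  · rintro rfl
    exact ⟨LieModuleEquiv.refl⟩
  · intro V _ _ _ _ ⟨v, hv, hgen⟩ hirr
    obtain ⟨ξ, hξ⟩ := W22.exists_hasCentralCharacter hgen
    have := LieModule.nontrivial_of_isIrreducible ℂ W22 V
    obtain ⟨e⟩ := W22.nonempty_model_equiv h2 hv (hξ v) hgen
    obtain ⟨e'⟩ := W22.LMod.nonempty_model_equiv ξ h2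
    exact ⟨ξ, hξ, ⟨e.symm.trans e'⟩⟩
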